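/- **Definitions.** Graphs are loopless undirected graphs in which parallel edges are allowed. For a set $X$ and an element $a$ write $X+a=X\cup\{a\}$ and $X-a=X\setminus\{a\}$. For a graph $G=(V,E)$, a *tree pair* of $G$ is an ordered pair $(S,T)$ of disjoint spanning trees (as edge sets) with $S\cup T=E$; $G$ is *bispanning* if it has a tree pair, and *atomic* if it is bispanning and its only bispanning subgraphs are $G$ itself and the single vertices. For a spanning tree $T$, $C_G(T,e)$ ($e\notin T$) is the edge set of the unique cycle in $T+e$, and $D_G(T,e)$ ($e\in T$) is the set of edges of $G$ joining the two components of $(V,T-e)$. Given a tree pair $(S,T)$, let $D_G(\cdot,e)$ be the cut with respect to the tree of the pair containing $e$, and $C_G(\cdot,e)$ the cycle with respect to the other tree. A *unique exchange* of $G$ is a quadruple $(e,f,S,T)$ where $(S,T)$ is a tree pair and either $e\in S$ and $f$ is the only edge of $T$ such that $(S-e+f,\,T+e-f)$ is a tree pair, or $e\in T$ and $f$ is the only edge of $S$ such that $(S+e-f,\,T-e+f)$ is a tree pair; the tree pair so obtained is its *result*. The unique exchanges are the arcs of the directed unique exchange graph $\vec\tau_3(G)$. Let $G$ be an atomic bispanning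 graph and $v$ a vertex of degree three, with neighbours $x,y,z$ and incident edges $e_x,e_y,e_z$, where $e_u$ joins $v$ and $u$. Whenever $\{a,b,c\}=\{x,y,z\}$, let $G_{a,b}$ be the *reduction graph* obtained from $G$ by deleting $v$ and adding one new edge $e_{a,b}$ with ends $a,b$ (equivalently, contracting $e_a$, deleting $e_c$, and renaming $e_b$ to $e_{a,b}$). For a tree pair $(S,T)$ of $G_{a,b}$ put $$\rho_{e_{a,b},c}(S,T)=\begin{cases}(S-e_{a,b}+e_a+e_b,\;T+e_c)&\text{if } e_{a,b}\in S,\\ (S+e_c,\;T-e_{a,b}+e_a+e_b)&\text{if } e_{a,b}\in T.\end{cases}$$ For a tree pair $(S,T)$ of $G$, name the three edges so that $e_a,e_b$ lie in the same tree and the *attachment edge* $e_c$ in the other, and so that $e_a\in C_G(\cdot,e_c)$ (the *cycle edge*) and $e_b\notin C_G(\cdot,e_c)$ (the *non-cycle edge*). **Theorem.** Every unique exchange of $G$ belongs to exactly one of the following four classes, and conversely every member of these classes is a unique exchange of $G$. 1. (Lifted) $(e,f,\rho_{e_{a,b},c}(S,T))$, where $\{a,b,c\}=\{x,y,z\}$,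 $(e,f,S,T)$ is a unique exchange of $G_{a,b}$ with $e,f\ne e_{a,b}$, and it is not *broken*, that is, either $$e_{a,b}\in S\ \text{ and }\ e\notin D_{G_{a,b}}(S,e_{a,b})\cap C_G(T+e_c,e_a)\cap C_G(T+e_c,e_b),$$ or $$e_{a,b}\in T\ \text{ and }\ e\notin D_{G_{a,b}}(T,e_{a,b})\cap C_G(S+e_c,e_a)\cap C_G(S+e_c,e_b).$$ 2. (Leaf) $(e_c,e_a,S,T)$, where $(S,T)$ is a tree pair of $G$ with attachment edge $e_c$ and cycle edge $e_a$. 3. (Forwarded) for $\{a,b,c\}=\{x,y,z\}$ and a unique exchange $(g,e_{a,b},S,T)$ of $G_{a,b}$: the exchange $(g,e_2,\rho_{e_{a,b},c}(S,T))$ and its reverse $(e_2,g,S',T')$, where $e_2$ is the one of $e_a,e_b$ that lies in the cut $D_G(\cdot,g)$ for the tree pair $\rho_{e_{a,b},c}(S,T)$, and $(S',T')$ is the result of $(g,e_2,\rho_{e_{a,b},c}(S,T))$. 4. (Extra) $(e_a,e_c,S,T)$, where $(S,T)$ is a tree pair of $G$ with attachment edge $e_c$ and cycle edge $e_a$, and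 $D_G(\cdot,e_a)\cap C_G(\cdot,e_a)=\{e_a,e_c\}$. Moreover, every tree pair of $G$ has exactly one exchange in class 2, and for every unique exchange $(g,e_{a,b},S,T)$ of $G_{a,b}$ exactly one of $e_a,e_b$ qualifies as $e_2$ in class 3. -/

import Mathlib

open scoped Graph

namespace Graph

universe u w

variable {α : Type u} {β : Type w}

/-! ### Walks, cycles, trees -/

/-- `G.IsWalk s l t`: the list `l = [(e₁, v₁), …, (eₙ, vₙ)]` encodes an edge walk
`s = v₀, e₁, v₁, e₂, …, eₙ, vₙ = t` of `G`. -/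
inductive IsWalk (G : Graph α β) : α → List (β × α) → α → Prop
  | nil {s : α} (hs : s ∈ V(G)) : IsWalk G s [] s
  | cons {s m t : α} {e : β} {l : List (β × α)} (h : G.IsLink e s m) (hl : IsWalk G m l t) :
      IsWalk G s ((e, m) :: l) t

/-- The edge set of a cycle: a closed walk of positive length that repeats no edge, and no vertex
except that it ends where it starts. (A loop would be a cycle of length one, two parallel edges
form a cycle of length two.) -/
def IsCycle (G : Graph α β) (C : Set β) : Prop :=
  ∃ (s : α) (l : List (β × α)), l ≠ [] ∧ G.IsWalk s l s ∧
    (l.map Prod.fst).Nodup ∧ (l.map Prod.snd).Nodup ∧ C = {e | e ∈ l.map Prod.fst}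

/-- Two vertices joined by a walk. -/
def Joined (G : Graph α β) (s t : α) : Prop := ∃ l, G.IsWalk s l t

/-- A tree-graph: nonempty, connected, without cycles. -/
structure IsTreeGraph (G : Graph α β) : Prop where
  nonempty : V(G).Nonempty
  connected : ∀ s ∈ V(G), ∀ t ∈ V(G), G.Joined s t
  acyclic : ∀ C, ¬ G.IsCycle C

/-- `T` is (the edge set of) a spanning tree of `G`. -/
def IsSpanningTree (G : Graph α β) (T : Set β) : Prop :=
  T ⊆ E(G) ∧ (G.restrict T).IsTreeGraph

/-- `C_G(T, e)`: the edges of the cycle in `T + e`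
(for a spanning tree `T` and an edge `e ∉ T` there is exactly one). -/
def fundCycle (G : Graph α β) (T : Set β) (e : β) : Set β :=
  {f | ∃ C, (G.restrict (insert e T)).IsCycle C ∧ f ∈ C}

/-- `D_G(T, e)`: the edges of `G` whose ends lie in different components of `(V, T - e)`. -/
def fundCut (G : Graph α β) (T : Set β) (e : β) : Set β :=
  {f | ∃ s t, G.IsLink f s t ∧ ¬ (G.restrict (T \ {e})).Joined s t}

/-! ### Bispanning graphs and the directed unique exchange graph -/

/-- `(S, T)` is a vertex of the exchange graph: `E` is the disjoint union of the spanning trees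
`S` and `T`. -/
structure IsTreePair (G : Graph α β) (S T : Set β) : Prop where
  left : G.IsSpanningTree S
  right : G.IsSpanningTree T
  disjoint : Disjoint S T
  union : S ∪ T = E(G)

/-- A graph whose edge set is the disjoint union of two spanning trees. -/
def IsBispanning (G : Graph α β) : Prop := ∃ S T, G.IsTreePair S T

/-- A bispanning graph whose only bispanning subgraphs are itself and single vertices. -/
def IsAtomic (G : Graph α β) : Prop :=
  G.IsBispanning ∧ ∀ H : Graph α β, H ≤ G → H.IsBispanning → H = G ∨ ∃ u, V(H) = {u}

/-- The number of edges incident to `v`. -/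
noncomputable def deg (G : Graph α β) (v : α) : ℕ∞ := {e | G.Inc e v}.encard

/-- `(e, f) ∈ S × T` is a unique `S` edge exchange: `f` is the only edge of `T` such that
`(S - e + f, T + e - f)` is again a pair of disjoint spanning trees. -/
def IsUniqueExchange (G : Graph α β) (S T : Set β) (e f : β) : Prop :=
  e ∈ S ∧ f ∈ T ∧ G.IsTreePair (insert f (S \ {e})) (insert e T \ {f}) ∧
    ∀ f' ∈ T, G.IsTreePair (insert f' (S \ {e})) (insert e T \ {f'}) → f' = f

/-- `(e, f, S, T)` is an arc of the directed unique exchange graph of `G`: a unique `S` edge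
exchange or a unique `T` edge exchange for the tree pair `(S, T)`. -/
def IsTauArc (G : Graph α β) (e f : β) (S T : Set β) : Prop :=
  G.IsTreePair S T ∧ (G.IsUniqueExchange S T e f ∨ G.IsUniqueExchange T S e f)

open Classical in
/-- The head of the arc `(e, f, S, T)`: the tree pair after the exchange. -/
noncomputable def exchange (e f : β) (S T : Set β) : Set β × Set β :=
  if e ∈ S then (insert f (S \ {e}), insert e T \ {f})
  else (insert e S \ {f}, insert f (T \ {e}))

/-- `D_G(·, e)`: the fundamental cut of `e` with respect to the tree of `(S, T)` containing `e`. -/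
def pairCut (G : Graph α β) (S T : Set β) (e : β) : Set β :=
  {f | (e ∈ S ∧ f ∈ G.fundCut S e) ∨ (e ∈ T ∧ f ∈ G.fundCut T e)}

/-- `C_G(·, e)`: the fundamental cycle of `e` with respect to the tree of `(S, T)` not
containing `e`. -/
def pairCycle (G : Graph α β) (S T : Set β) (e : β) : Set β :=
  {f | (e ∈ S ∧ f ∈ G.fundCycle T e) ∨ (e ∈ T ∧ f ∈ G.fundCycle S e)}

/-! ### Reduction at a vertex of degree three -/

/-- The reduction graph `G_{a,b}` at the vertex `v`: `v` is deleted with its incident edges, and one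
new edge `e_{a,b}` with ends `a` and `b` is added. The edges `e` of `G - v` are labelled `some e`,
the split edge `e_{a,b}` is labelled `none`. For `v` of degree three with neighbours `a, b, c` this
is `G / {v,a} - {v,c}` with the edge `{v,b}` renamed. -/
def reduction (G : Graph α β) (v a b : α) : Graph α (Option β) where
  vertexSet := V(G) \ {v}
  IsLink e s t :=
    (∃ e' : β, e = some e' ∧ (G.deleteVerts {v}).IsLink e' s t) ∨
    (e = none ∧ a ∈ V(G) \ {v} ∧ b ∈ V(G) \ {v} ∧ ((s = a ∧ t = b) ∨ (s = b ∧ t = a)))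
  isLink_symm := by
    intro e _
    refine ⟨fun s t h => ?_⟩
    rcases h with ⟨e', he, h⟩ | ⟨he, ha, hb, h⟩
    · exact Or.inl ⟨e', he, h.symm⟩
    · exact Or.inr ⟨he, ha, hb, h.symm.imp And.symm And.symm⟩
  eq_or_eq_of_isLink_of_isLink := by
    rintro e s t p q (⟨e', rfl, h⟩ | ⟨rfl, -, -, h⟩) (⟨e'', he, h'⟩ | ⟨he, -, -, h'⟩)
    · obtain rfl := Option.some.inj he
      exact h.left_eq_or_eq h'
    · simp at he
    · simp at he
    · grind
  left_mem_of_isLink := by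
    rintro e s t (⟨e', rfl, h⟩ | ⟨rfl, ha, hb, ⟨rfl, rfl⟩ | ⟨rfl, rfl⟩⟩)
    · simpa using h.left_mem
    · exact ha
    · exact hb

open Classical in
/-- The edge-split-attach operation `ρ` on tree pairs of a reduction graph: the split edge is
replaced by `ea` and `eb` in its tree, and `ec` is added to the other tree. -/
noncomputable def rho (ea eb ec : β) (S T : Set (Option β)) : Set β × Set β :=
  if none ∈ S then (some ⁻¹' S ∪ {ea, eb}, some ⁻¹' T ∪ {ec})
  else (some ⁻¹' S ∪ {ec}, some ⁻¹' T ∪ {ea, eb})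

/-- The condition under which an exchange from `e` for the tree pair `(S, T)` of the reduction
graph `H = G_{a,b}` is not broken by `ρ`. -/
def NotBroken (G : Graph α β) (H : Graph α (Option β)) (ea eb ec e : β)
    (S T : Set (Option β)) : Prop :=
  (none ∈ S ∧ ¬ (some e ∈ H.fundCut S none ∧
    e ∈ G.fundCycle (some ⁻¹' T ∪ {ec}) ea ∧ e ∈ G.fundCycle (some ⁻¹' T ∪ {ec}) eb)) ∨
  (none ∈ T ∧ ¬ (some e ∈ H.fundCut T none ∧
    e ∈ G.fundCycle (some ⁻¹' S ∪ {ec}) ea ∧ e ∈ G.fundCycle (some ⁻¹' S ∪ {ec}) eb))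

/-- For the tree pair `(S, T)`, `ec` is the attachment edge (the only one of the three of its
colour), `ea` the cycle edge and `eb` the non-cycle edge. -/
def HasRoles (G : Graph α β) (ea eb ec : β) (S T : Set β) : Prop :=
  G.IsTreePair S T ∧ ((ea ∈ S ∧ eb ∈ S ∧ ec ∈ T) ∨ (ea ∈ T ∧ eb ∈ T ∧ ec ∈ S)) ∧
    ea ∈ G.pairCycle S T ec ∧ eb ∉ G.pairCycle S T ec

/-- Pairwise distinct indices: `i`, `j`, `k` assign the names `a`, `b`, `c` to the three
neighbours. -/
def Distinct (i j k : Fin 3) : Prop := i ≠ j ∧ i ≠ k ∧ j ≠ k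

/-- `e₂` is the edge to which an exchange `(g, e_{a,b}, S, T)` of `G_{a,b}` is forwarded: the one of
`ea`, `eb` lying in the cut `D_G(·, g)` of the lifted tree pair `ρ(S, T)`. -/
def IsForwardEdge (G : Graph α β) (ea eb ec g : β) (S T : Set (Option β)) (e₂ : β) : Prop :=
  (e₂ = ea ∨ e₂ = eb) ∧ e₂ ∈ G.pairCut (rho ea eb ec S T).1 (rho ea eb ec S T).2 g

/-- The names of the four classes. -/
inductive ExchangeClass
  | lifted
  | leaf
  | forwarded
  | extra

/-- Membership of `(e, f, S, T)` in each of the four classes, where `v` is a vertex of degree three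
with neighbours `x 0, x 1, x 2` and incident edges `d 0, d 1, d 2`. -/
def InClass (G : Graph α β) (v : α) (x : Fin 3 → α) (d : Fin 3 → β) (e f : β) (S T : Set β) :
    ExchangeClass → Prop
  | .lifted => ∃ i j k, Distinct i j k ∧ ∃ S₀ T₀ : Set (Option β),
      (G.reduction v (x i) (x j)).IsTauArc (some e) (some f) S₀ T₀ ∧
      G.NotBroken (G.reduction v (x i) (x j)) (d i) (d j) (d k) e S₀ T₀ ∧
      (S, T) = rho (d i) (d j) (d k) S₀ T₀
  | .leaf => ∃ i j k, Distinct i j k ∧ G.HasRoles (d i) (d j) (d k) S T ∧ e = d k ∧ f = d i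
  | .forwarded => ∃ i j k, Distinct i j k ∧ ∃ (S₀ T₀ : Set (Option β)) (g e₂ : β),
      (G.reduction v (x i) (x j)).IsTauArc (some g) none S₀ T₀ ∧
      G.IsForwardEdge (d i) (d j) (d k) g S₀ T₀ e₂ ∧
      ((e = g ∧ f = e₂ ∧ (S, T) = rho (d i) (d j) (d k) S₀ T₀) ∨
       (e = e₂ ∧ f = g ∧ (S, T) = exchange g e₂ (rho (d i) (d j) (d k) S₀ T₀).1
          (rho (d i) (d j) (d k) S₀ T₀).2))
  | .extra => ∃ i j k, Distinct i j k ∧ G.HasRoles (d i) (d j) (d k) S T ∧ e = d i ∧ f = d k ∧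
      G.pairCut S T (d i) ∩ G.pairCycle S T (d i) = {d i, d k}

end Graph

/-!
Whether an exchange is possible is decided by fundamental cuts: in a tree pair `(S, T)` the edges
`e ∈ S` and `f ∈ T` can be exchanged if and only if `f` lies in the cut of `e` and `e` in the cut
of `f`. At a vertex `v` of degree three every tree pair has the form `(A + e_a + e_b, B + e_c)` with
`A`, `B` avoiding `v`, and it comes from the tree pair `(A + e_{a,b}, B)` of `G_{a,b}`. Passing
between the two changes no cut away from `v`, so only the partners at `v` have to be compared. An
edge `g ∈ B` crosses the cut of `e_{a,b}` exactly when it crosses the cuts of `e_a` and `e_b`.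
Conversely `B - g` has two components, so `a` and `b` are separated, i.e. `e_{a,b}` crosses the cut
of `g`, if and only if exactly one of `a`, `b` is separated from `c`, i.e. exactly one of `e_a`,
`e_b` crosses the cut of `g` in `B + e_c`. Hence `e_{a,b}` is a partner of `g` if and only if
exactly one of `e_a`, `e_b` is; the broken exchanges are those where both are. Finally `e_c` is a
leaf of its tree, so its only partner is the cycle edge.
-/

section

open Graph

universe u w

variable {α : Type u} {β : Type w} {G : Graph α β} {A B S T : Set β} {e f g ea eb ec : β}
  {v a b c s t p q r : α} {x : Fin 3 → α} {d : Fin 3 → β} {i j k i' j' k' : Fin 3}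

namespace BispanningGraph

/-! ### Connectedness by a set of edges -/

/-- `Conn G A s t`: the vertices `s` and `t` are joined by edges from `A`. No vertex is required to
belong to `G`, so the relation is reflexive on the whole type. -/
def Conn (G : Graph α β) (A : Set β) : α → α → Prop :=
  Relation.ReflTransGen fun s t => ∃ e ∈ A, G.IsLink e s t

/-- `Connects G A`: the edges from `A` join any two vertices of `G`. -/
def Connects (G : Graph α β) (A : Set β) : Prop := ∀ s ∈ V(G), ∀ t ∈ V(G), Conn G A s t

/-- `IsForest G A`: no edge from `A` has its ends joined by the other edges from `A`. -/
def IsForest (G : Graph α β) (A : Set β) : Prop :=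
  ∀ f ∈ A, ∀ s t, G.IsLink f s t → ¬ Conn G (A \ {f}) s t

lemma Conn.refl (G : Graph α β) (A : Set β) (s : α) : Conn G A s s := Relation.ReflTransGen.refl

lemma Conn.trans (h : Conn G A s t) (h' : Conn G A t p) : Conn G A s p :=
  Relation.ReflTransGen.trans h h'

lemma Conn.symm (h : Conn G A s t) : Conn G A t s :=
  have : Std.Symm fun s t => ∃ e ∈ A, G.IsLink e s t :=
    ⟨fun _ _ ⟨e, he, hl⟩ => ⟨e, he, hl.symm⟩⟩
  Relation.ReflTransGen.stdSymm.symm _ _ h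

lemma conn_comm : Conn G A s t ↔ Conn G A t s := ⟨Conn.symm, Conn.symm⟩

lemma Conn.mono (h : Conn G A s t) (hAB : A ⊆ B) : Conn G B s t :=
  Relation.ReflTransGen.mono (fun _ _ ⟨e, he, hl⟩ => ⟨e, hAB he, hl⟩) _ _ h

lemma conn_of_isLink (h : G.IsLink e s t) (he : e ∈ A) : Conn G A s t :=
  Relation.ReflTransGen.single ⟨e, he, h⟩

lemma conn_iff_of_isLink (h : G.IsLink e s t) (h' : G.IsLink e p q) :
    Conn G A s t ↔ Conn G A p q := by
  rcases h.eq_and_eq_or_eq_and_eq h' with ⟨rfl, rfl⟩ | ⟨rfl, rfl⟩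
  · rfl
  · exact conn_comm

lemma conn_insert_iff (h : G.IsLink e s t) : Conn G (insert e A) p q ↔
    Conn G A p q ∨ (Conn G A p s ∧ Conn G A t q) ∨ (Conn G A p t ∧ Conn G A s q) := by
  have hA : A ⊆ insert e A := Set.subset_insert _ _
  have hst : Conn G (insert e A) s t := conn_of_isLink h (Set.mem_insert _ _)
  constructor
  · intro hpq
    induction hpq with
    | refl => exact .inl (.refl G A _)
    | tail _ hstep ih =>
      obtain ⟨f, rfl | hf, hl⟩ := hstep
      · have := Conn.refl G A
        rcases hl.eq_and_eq_or_eq_and_eq h with ⟨rfl, rfl⟩ | ⟨rfl, rfl⟩ <;> tauto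
      · have hlast := conn_of_isLink hl hf
        exact ih.imp (·.trans hlast)
          (Or.imp (And.imp_right (·.trans hlast)) (And.imp_right (·.trans hlast)))
  · rintro (hpq | ⟨hp, hq⟩ | ⟨hp, hq⟩)
    · exact hpq.mono hA
    · exact (hp.mono hA).trans (hst.trans (hq.mono hA))
    · exact (hp.mono hA).trans (hst.symm.trans (hq.mono hA))

lemma IsForest.mono (h : IsForest G B) (hAB : A ⊆ B) : IsForest G A :=
  fun f hf s t hst hc => h f (hAB hf) s t hst (hc.mono (Set.sdiff_subset_sdiff_left hAB))

lemma isForest_insert_iff (h : G.IsLink e s t) (he : e ∉ A) :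
    IsForest G (insert e A) ↔ IsForest G A ∧ ¬ Conn G A s t := by
  constructor
  · intro hF
    have hst := hF e (Set.mem_insert _ _) s t h
    rw [Set.insert_sdiff_self_of_notMem he] at hst
    exact ⟨hF.mono (Set.subset_insert _ _), hst⟩
  · rintro ⟨hF, hst⟩ f (rfl | hf) p q hpq hc
    · rw [Set.insert_sdiff_self_of_notMem he] at hc
      exact hst ((conn_iff_of_isLink h hpq).2 hc)
    · have hef : e ∉ ({f} : Set β) := fun hef => he (hef ▸ hf)
      have hA : A \ {f} ⊆ A := Set.sdiff_subset
      have hpq' := conn_of_isLink hpq hf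
      rw [Set.insert_sdiff_of_notMem _ hef, conn_insert_iff h] at hc
      rcases hc with hc | ⟨h1, h2⟩ | ⟨h1, h2⟩
      · exact hF f hf p q hpq hc
      · exact hst ((h1.mono hA).symm.trans (hpq'.trans (h2.mono hA).symm))
      · exact hst ((h2.mono hA).trans (hpq'.symm.trans (h1.mono hA)))

/-! ### Walks and cycles -/

/-- A walk that repeats neither a vertex nor an edge. -/
def IsPathWalk (G : Graph α β) (s : α) (l : List (β × α)) (t : α) : Prop :=
  G.IsWalk s l t ∧ (s :: l.map Prod.snd).Nodup ∧ (l.map Prod.fst).Nodup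

end BispanningGraph

open BispanningGraph

namespace Graph.IsWalk

variable {H : Graph α β} {l : List (β × α)}

lemma of_le (h : H.IsWalk s l t) (hle : H ≤ G) : G.IsWalk s l t := by
  induction h with
  | nil hs => exact .nil (hle.vertexSet_mono hs)
  | cons hl _ ih => exact .cons (hl.mono hle) ih

lemma mem_edgeSet (h : G.IsWalk s l t) (hf : f ∈ l.map Prod.fst) : f ∈ E(G) := by
  induction h with
  | nil => simp at hf
  | cons hl _ ih =>
    rw [List.map_cons, List.mem_cons] at hf
    rcases hf with rfl | hf
    exacts [hl.edge_mem, ih hf]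

lemma mem_of_isLink (h : G.IsWalk s l t) (hf : f ∈ l.map Prod.fst) (hpq : G.IsLink f p q) :
    p ∈ s :: l.map Prod.snd := by
  induction h with
  | nil => simp at hf
  | cons hl _ ih =>
    rw [List.map_cons, List.mem_cons] at hf
    rcases hf with rfl | hf
    · rcases hpq.left_eq_or_eq hl with rfl | rfl <;> simp
    · exact List.mem_cons_of_mem _ (ih hf)

lemma conn (h : (G.restrict A).IsWalk s l t) : Conn G A s t := by
  induction h with
  | nil => exact .refl G A _
  | cons hl _ ih => exact (conn_of_isLink hl.2 hl.1).trans ih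

lemma conn_sdiff (h : (G.restrict A).IsWalk s l t) (hf : f ∉ l.map Prod.fst) :
    Conn G (A \ {f}) s t := by
  induction h with
  | nil => exact .refl G _ _
  | cons hl _ ih =>
    rw [List.map_cons, List.mem_cons, not_or] at hf
    exact (conn_of_isLink (A := A \ {f}) hl.2 ⟨hl.1, Ne.symm hf.1⟩).trans (ih hf.2)

lemma exists_isLink_of_mem (h : (G.restrict A).IsWalk s l t) (hl : (l.map Prod.fst).Nodup)
    (hf : f ∈ l.map Prod.fst) :
    ∃ p q, G.IsLink f p q ∧ Conn G (A \ {f}) s p ∧ Conn G (A \ {f}) q t := by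
  induction h with
  | nil => simp at hf
  | @cons s m t e l hlink hw ih =>
    rw [List.map_cons, List.nodup_cons] at hl
    rw [List.map_cons, List.mem_cons] at hf
    by_cases hfe : f = e
    · subst hfe
      exact ⟨s, m, hlink.2, .refl G _ _, hw.conn_sdiff hl.1⟩
    · obtain ⟨p, q, hpq, hsp, hqt⟩ := ih hl.2 (hf.resolve_left hfe)
      have hsm := conn_of_isLink (A := A \ {f}) hlink.2 ⟨hlink.1, Ne.symm hfe⟩
      exact ⟨p, q, hpq, hsm.trans hsp, hqt⟩

end Graph.IsWalk

namespace BispanningGraph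

lemma IsPathWalk.exists_of_mem {l : List (β × α)} (h : IsPathWalk G s l t)
    (hp : p ∈ s :: l.map Prod.snd) : ∃ l', IsPathWalk G p l' t := by
  obtain ⟨hw, hv, he⟩ := h
  induction hw with
  | nil hs =>
    obtain rfl := List.mem_singleton.1 hp
    exact ⟨[], .nil hs, hv, he⟩
  | cons hl hw ih =>
    rcases List.mem_cons.1 hp with rfl | hp
    · exact ⟨_, .cons hl hw, hv, he⟩
    · exact ih hp (List.nodup_cons.1 hv).2 (List.nodup_cons.1 he).2

lemma Conn.exists_isPathWalk (h : Conn G A s t) (ht : t ∈ V(G)) :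
    ∃ l, IsPathWalk (G.restrict A) s l t := by
  induction h using Relation.ReflTransGen.head_induction_on with
  | refl => exact ⟨[], .nil ht, by simp, by simp⟩
  | @head s m hsm _ ih =>
    obtain ⟨e, heA, hl⟩ := hsm
    obtain ⟨l, hlw⟩ := ih
    by_cases hs : s ∈ m :: l.map Prod.snd
    · exact hlw.exists_of_mem hs
    · have hl' : (G.restrict A).IsLink e s m := ⟨heA, hl⟩
      exact ⟨(e, m) :: l, .cons hl' hlw.1, List.nodup_cons.2 ⟨hs, hlw.2.1⟩,
        List.nodup_cons.2 ⟨fun he => hs (hlw.1.mem_of_isLink he hl'), hlw.2.2⟩⟩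

lemma joined_restrict_iff (ht : t ∈ V(G)) : (G.restrict A).Joined s t ↔ Conn G A s t :=
  ⟨fun ⟨_, h⟩ => h.conn, fun h => let ⟨l, hl⟩ := h.exists_isPathWalk ht; ⟨l, hl.1⟩⟩

lemma exists_isCycle_iff (h : G.IsLink f s t) : (∃ C, (G.restrict A).IsCycle C ∧ f ∈ C) ↔
    f ∈ A ∧ Conn G (A \ {f}) s t := by
  constructor
  · rintro ⟨C, ⟨u, l, -, hw, he, -, rfl⟩, hf⟩
    obtain ⟨p, q, hpq, hup, hqu⟩ := hw.exists_isLink_of_mem he hf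
    exact ⟨(hw.mem_edgeSet hf).2, (conn_iff_of_isLink h hpq).2 (hqu.trans hup).symm⟩
  · rintro ⟨hfA, hc⟩
    obtain ⟨l, hw, hv, he⟩ := hc.symm.exists_isPathWalk h.left_mem
    have hf : f ∉ l.map Prod.fst := fun hf => (hw.mem_edgeSet hf).2.2 rfl
    have hw' : (G.restrict A).IsWalk t l s := hw.of_le (G.restrict_mono_right Set.sdiff_subset)
    exact ⟨_, ⟨s, (f, t) :: l, by simp, .cons ⟨hfA, h⟩ hw', List.nodup_cons.2 ⟨hf, he⟩, hv, rfl⟩,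
      by simp⟩

/-! ### Spanning trees, fundamental cuts and fundamental cycles -/

lemma isForest_iff_forall_not_isCycle : IsForest G A ↔ ∀ C, ¬ (G.restrict A).IsCycle C := by
  constructor
  · rintro hF C hC
    obtain ⟨f, hf⟩ : C.Nonempty := by
      obtain ⟨_, l, hl, -, -, -, rfl⟩ := hC
      obtain ⟨m, hm⟩ := List.exists_mem_of_ne_nil l hl
      exact ⟨m.1, List.mem_map_of_mem hm⟩
    obtain ⟨s, t, hst⟩ : ∃ s t, G.IsLink f s t := by
      obtain ⟨_, _, -, hw, -, -, rfl⟩ := hC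
      exact exists_isLink_of_mem_edgeSet (hw.mem_edgeSet hf).1
    obtain ⟨hfA, hc⟩ := (exists_isCycle_iff hst).1 ⟨C, hC, hf⟩
    exact hF f hfA s t hst hc
  · intro hA f hf s t hst hc
    obtain ⟨C, hC, -⟩ := (exists_isCycle_iff hst).2 ⟨hf, hc⟩
    exact hA C hC

lemma isSpanningTree_iff : G.IsSpanningTree T ↔
    T ⊆ E(G) ∧ V(G).Nonempty ∧ Connects G T ∧ IsForest G T := by
  have hconn : Connects G T ↔ ∀ s ∈ V(G), ∀ t ∈ V(G), (G.restrict T).Joined s t :=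
    forall₄_congr fun s _ t ht => (joined_restrict_iff ht).symm
  rw [hconn, isForest_iff_forall_not_isCycle]
  exact and_congr_right fun _ => ⟨fun h => ⟨h.1, h.2, h.3⟩, fun h => ⟨h.1, h.2.1, h.2.2⟩⟩

lemma mem_fundCut_iff (h : G.IsLink f s t) : f ∈ G.fundCut T e ↔ ¬ Conn G (T \ {e}) s t := by
  constructor
  · rintro ⟨p, q, hpq, hc⟩
    rwa [joined_restrict_iff hpq.right_mem, conn_iff_of_isLink hpq h] at hc
  · exact fun hc => ⟨s, t, h, by rwa [joined_restrict_iff h.right_mem]⟩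

lemma mem_fundCycle_iff (h : G.IsLink f s t) :
    f ∈ G.fundCycle T e ↔ f ∈ insert e T ∧ Conn G (insert e T \ {f}) s t :=
  exists_isCycle_iff h

end BispanningGraph

namespace Graph.IsSpanningTree

lemma connects (hT : G.IsSpanningTree T) : Connects G T := (isSpanningTree_iff.1 hT).2.2.1

lemma isForest (hT : G.IsSpanningTree T) : IsForest G T := (isSpanningTree_iff.1 hT).2.2.2

lemma exists_isLink (hT : G.IsSpanningTree T) (he : e ∈ T) : ∃ s t, G.IsLink e s t :=
  exists_isLink_of_mem_edgeSet (hT.1 he)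

lemma conn_or_conn (hT : G.IsSpanningTree T) (he : e ∈ T) (h : G.IsLink e s t) (hp : p ∈ V(G)) :
    Conn G (T \ {e}) p s ∨ Conn G (T \ {e}) p t := by
  have hc := hT.connects p hp s h.left_mem
  rw [← Set.insert_sdiff_self_of_mem he, conn_insert_iff h] at hc
  exact hc.imp_right (Or.elim · (fun h' => absurd h'.2.symm (hT.isForest e he s t h)) And.left)

lemma conn_of_not_conn (hT : G.IsSpanningTree T) (he : e ∈ T) (hp : p ∈ V(G)) (hq : q ∈ V(G))
    (hr : r ∈ V(G)) (hpq : ¬ Conn G (T \ {e}) p q) (hqr : ¬ Conn G (T \ {e}) q r) :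
    Conn G (T \ {e}) p r := by
  obtain ⟨s, t, h⟩ := hT.exists_isLink he
  have := hT.conn_or_conn he h hp
  have := hT.conn_or_conn he h hq
  have := hT.conn_or_conn he h hr
  grind [Conn.symm, Conn.trans]

lemma self_mem_fundCut (hT : G.IsSpanningTree T) (he : e ∈ T) : e ∈ G.fundCut T e := by
  obtain ⟨s, t, h⟩ := hT.exists_isLink he
  exact (mem_fundCut_iff h).2 (hT.isForest e he s t h)

lemma eq_of_mem_fundCut (hT : G.IsSpanningTree T) (hf : f ∈ T) (h : f ∈ G.fundCut T e) :
    f = e := by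
  obtain ⟨s, t, hst⟩ := hT.exists_isLink hf
  by_contra hne
  exact (mem_fundCut_iff hst).1 h (conn_of_isLink hst ⟨hf, hne⟩)

lemma self_mem_fundCycle (hT : G.IsSpanningTree T) (hf : f ∈ E(G)) (hfT : f ∉ T) :
    f ∈ G.fundCycle T f := by
  obtain ⟨s, t, h⟩ := exists_isLink_of_mem_edgeSet hf
  rw [mem_fundCycle_iff h, Set.insert_sdiff_self_of_notMem hfT]
  exact ⟨Set.mem_insert _ _, hT.connects s h.left_mem t h.right_mem⟩

lemma insert_sdiff_iff (hT : G.IsSpanningTree T) (he : e ∈ T) (hf : f ∈ E(G)) (hfT : f ∉ T) :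
    G.IsSpanningTree (insert f (T \ {e})) ↔ f ∈ G.fundCut T e := by
  obtain ⟨s, t, h⟩ := exists_isLink_of_mem_edgeSet hf
  have hforest : IsForest G (insert f (T \ {e})) ↔ ¬ Conn G (T \ {e}) s t := by
    rw [isForest_insert_iff h fun h' => hfT h'.1,
      and_iff_right (hT.isForest.mono Set.sdiff_subset)]
  rw [mem_fundCut_iff h, isSpanningTree_iff, ← hforest]
  refine ⟨fun h' => h'.2.2.2, fun h' => ⟨?_, ⟨s, h.left_mem⟩, fun p hp q hq => ?_, h'⟩⟩
  · exact Set.insert_subset hf (Set.sdiff_subset.trans hT.1)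
  · have := hforest.1 h'
    have := hT.conn_of_not_conn he hp h.left_mem hq
    have := hT.conn_of_not_conn he h.left_mem hp h.right_mem
    have := hT.conn_of_not_conn he h.left_mem hq h.right_mem
    rw [conn_insert_iff h]
    grind [Conn.symm, Conn.trans]

lemma mem_fundCycle_iff_mem_fundCut (hT : G.IsSpanningTree T) (he : e ∈ T) (hf : f ∈ E(G))
    (hfT : f ∉ T) : e ∈ G.fundCycle T f ↔ f ∈ G.fundCut T e := by
  obtain ⟨s, t, h⟩ := exists_isLink_of_mem_edgeSet hf
  obtain ⟨p, q, h'⟩ := hT.exists_isLink he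
  have hfe : f ∉ ({e} : Set β) := fun hfe => hfT (hfe ▸ he)
  have hpq := hT.isForest e he p q h'
  have hs := hT.conn_or_conn he h' h.left_mem
  have ht := hT.conn_or_conn he h' h.right_mem
  rw [mem_fundCut_iff h, mem_fundCycle_iff h', and_iff_right (Set.mem_insert_of_mem _ he),
    Set.insert_sdiff_of_notMem _ hfe, conn_insert_iff h]
  grind [Conn.symm, Conn.trans]

end Graph.IsSpanningTree

/-! ### Tree pairs and exchanges -/

namespace BispanningGraph

/-- `CanExchange G S T e f`: the edges `e ∈ S` and `f ∈ T` of a tree pair can be exchanged, in the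
form of the criterion by fundamental cuts (`Graph.IsTreePair.exchange_iff`). -/
def CanExchange (G : Graph α β) (S T : Set β) (e f : β) : Prop :=
  f ∈ G.fundCut S e ∧ e ∈ G.fundCut T f

lemma canExchange_comm : CanExchange G S T e f ↔ CanExchange G T S f e := and_comm

end BispanningGraph

namespace Graph.IsTreePair

lemma symm (h : G.IsTreePair S T) : G.IsTreePair T S :=
  ⟨h.right, h.left, h.disjoint.symm, Set.union_comm _ _ ▸ h.union⟩

lemma notMem_right (h : G.IsTreePair S T) (he : e ∈ S) : e ∉ T := Set.disjoint_left.1 h.disjoint he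

lemma notMem_left (h : G.IsTreePair S T) (he : e ∈ T) : e ∉ S := Set.disjoint_right.1 h.disjoint he

lemma ne (h : G.IsTreePair S T) (he : e ∈ S) (hf : f ∈ T) : e ≠ f :=
  fun hef => h.notMem_right he (hef ▸ hf)

lemma mem_or_mem (h : G.IsTreePair S T) (he : e ∈ E(G)) : e ∈ S ∨ e ∈ T := by
  rwa [← h.union] at he

lemma exchange_iff (h : G.IsTreePair S T) (he : e ∈ S) (hf : f ∈ T) :
    G.IsTreePair (insert f (S \ {e})) (insert e T \ {f}) ↔ CanExchange G S T e f := by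
  have hef := h.ne he hf
  have heT := h.notMem_right he
  have hfS := h.notMem_left hf
  rw [Set.insert_sdiff_of_notMem _ (by simpa using hef), CanExchange,
    ← h.left.insert_sdiff_iff he (h.right.1 hf) hfS,
    ← h.right.insert_sdiff_iff hf (h.left.1 he) heT]
  refine ⟨fun h' => ⟨h'.left, h'.right⟩, fun h' => ⟨h'.1, h'.2, ?_, ?_⟩⟩
  · have := Set.disjoint_left.1 h.disjoint
    rw [Set.disjoint_left]
    grind
  · rw [← h.union]
    grind

lemma isUniqueExchange_iff (h : G.IsTreePair S T) : G.IsUniqueExchange S T e f ↔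
    e ∈ S ∧ f ∈ T ∧ ∀ f' ∈ T, CanExchange G S T e f' ↔ f' = f := by
  refine and_congr_right fun he => and_congr_right fun hf => ?_
  rw [h.exchange_iff he hf]
  constructor
  · rintro ⟨hcan, huniq⟩ f' hf'
    exact ⟨fun h' => huniq f' hf' ((h.exchange_iff he hf').2 h'), fun h' => h' ▸ hcan⟩
  · exact fun huniq => ⟨(huniq f hf).2 rfl,
      fun f' hf' h' => (huniq f' hf').1 ((h.exchange_iff he hf').1 h')⟩

lemma fundCut_inter_fundCycle_eq_iff (h : G.IsTreePair S T) (he : e ∈ S) (hf : f ∈ T) :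
    G.fundCut S e ∩ G.fundCycle T e = {e, f} ↔ G.IsUniqueExchange S T e f := by
  have heE := h.left.1 he
  have heT := h.notMem_right he
  have hcan : ∀ f' ∈ T, CanExchange G S T e f' ↔ f' ∈ G.fundCut S e ∩ G.fundCycle T e :=
    fun f' hf' => and_congr_right fun _ => (h.right.mem_fundCycle_iff_mem_fundCut hf' heE heT).symm
  have hself : e ∈ G.fundCut S e ∩ G.fundCycle T e :=
    ⟨h.left.self_mem_fundCut he, h.right.self_mem_fundCycle heE heT⟩
  have hsub : ∀ f' ∈ G.fundCut S e ∩ G.fundCycle T e, f' = e ∨ f' ∈ T := by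
    rintro f' ⟨hf', C, hC⟩
    obtain ⟨s, t, hst, -⟩ := hf'
    exact ((exists_isCycle_iff hst).1 ⟨C, hC⟩).1
  rw [h.isUniqueExchange_iff, Set.ext_iff, and_iff_right he, and_iff_right hf]
  grind

lemma pairCut_left (h : G.IsTreePair S T) (he : e ∈ S) : G.pairCut S T e = G.fundCut S e := by
  simp [pairCut, he, h.notMem_right he]

lemma pairCut_right (h : G.IsTreePair S T) (he : e ∈ T) : G.pairCut S T e = G.fundCut T e := by
  simp [pairCut, he, h.notMem_left he]

lemma pairCycle_left (h : G.IsTreePair S T) (he : e ∈ S) :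
    G.pairCycle S T e = G.fundCycle T e := by
  simp [pairCycle, he, h.notMem_right he]

lemma pairCycle_right (h : G.IsTreePair S T) (he : e ∈ T) :
    G.pairCycle S T e = G.fundCycle S e := by
  simp [pairCycle, he, h.notMem_left he]

end Graph.IsTreePair

lemma Graph.IsBispanning.ne_of_isLink (hG : G.IsBispanning) (h : G.IsLink e s t) :
    t ≠ s := by
  rintro rfl
  obtain ⟨S, T, hp⟩ := hG
  rcases hp.mem_or_mem h.edge_mem with he | he
  · exact hp.left.isForest e he t t h (.refl G _ t)
  · exact hp.right.isForest e he t t h (.refl G _ t)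

namespace Graph.IsTauArc

lemma left_mem_edgeSet (h : G.IsTauArc e f S T) : e ∈ E(G) :=
  h.2.elim (fun hu => h.1.left.1 hu.1) (fun hu => h.1.right.1 hu.1)

lemma right_mem_edgeSet (h : G.IsTauArc e f S T) : f ∈ E(G) :=
  h.2.elim (fun hu => h.1.right.1 hu.2.1) (fun hu => h.1.left.1 hu.2.1)

end Graph.IsTauArc

namespace BispanningGraph

lemma isTauArc_comm : G.IsTauArc e f S T ↔ G.IsTauArc e f T S :=
  ⟨fun h => ⟨h.1.symm, h.2.symm⟩, fun h => ⟨h.1.symm, h.2.symm⟩⟩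

lemma exchange_of_mem (he : e ∈ S) : exchange e f S T = (insert f (S \ {e}), insert e T \ {f}) :=
  if_pos he

lemma exchange_swap (he : e ∈ T) (heS : e ∉ S) : exchange e f S T = (exchange e f T S).swap := by
  rw [exchange_of_mem he, exchange, if_neg heS, Prod.swap_prod_mk]

end BispanningGraph

namespace Graph.IsUniqueExchange

lemma exchange_exchange (h : G.IsUniqueExchange S T e f) (hp : G.IsTreePair S T) :
    exchange f e (exchange e f S T).1 (exchange e f S T).2 = (S, T) := by
  obtain ⟨he, hf, -, -⟩ := h
  have := hp.notMem_right he
  have := hp.notMem_left hf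
  rw [exchange_of_mem he, exchange_of_mem (Set.mem_insert _ _)]
  ext <;> grind

lemma reverse (h : G.IsUniqueExchange S T e f) (hp : G.IsTreePair S T) :
    G.IsTauArc f e (exchange e f S T).1 (exchange e f S T).2 := by
  have hback := h.exchange_exchange hp
  obtain ⟨he, hf, hp', huniq⟩ := h
  rw [exchange_of_mem he, exchange_of_mem (Set.mem_insert _ _), Prod.mk.injEq] at hback
  rw [exchange_of_mem he]
  refine ⟨hp', .inl ⟨Set.mem_insert _ _, ⟨Set.mem_insert _ _, hp.ne he hf⟩, ?_, ?_⟩⟩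
  · rwa [hback.1, hback.2]
  · rintro f' ⟨rfl | hf', hff'⟩ hp''
    · rfl
    · rw [Set.insert_sdiff_self_of_notMem fun hfS => hp.notMem_left hf hfS.1,
        Set.insert_sdiff_self_of_mem (Set.mem_insert_of_mem _ hf)] at hp''
      exact absurd (huniq f' hf' hp'') hff'

end Graph.IsUniqueExchange

namespace Graph.IsTauArc

lemma exchange_exchange (h : G.IsTauArc e f S T) :
    exchange f e (exchange e f S T).1 (exchange e f S T).2 = (S, T) := by
  obtain ⟨hp, hu | hu⟩ := h
  · exact hu.exchange_exchange hp
  · have hback := hu.exchange_exchange hp.symm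
    rw [exchange_of_mem hu.1] at hback
    rw [exchange_swap hu.1 (hp.notMem_left hu.1), exchange_of_mem hu.1, Prod.fst_swap,
      Prod.snd_swap, exchange_swap (Set.mem_insert _ _) (by simp), hback, Prod.swap_prod_mk]

lemma reverse (h : G.IsTauArc e f S T) :
    G.IsTauArc f e (exchange e f S T).1 (exchange e f S T).2 := by
  obtain ⟨hp, hu | hu⟩ := h
  · exact hu.reverse hp
  · rw [exchange_swap hu.1 (hp.notMem_left hu.1), isTauArc_comm]
    exact hu.reverse hp.symm

end Graph.IsTauArc

/-! ### The reduction graph -/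

namespace BispanningGraph

/-- `Avoids G v A`: no edge from `A` is incident to `v`. -/
def Avoids (G : Graph α β) (v : α) (A : Set β) : Prop := ∀ e ∈ A, ¬ G.Inc e v

lemma ne_left_of_isLink (h : G.IsLink e s t) (he : ¬ G.Inc e v) : s ≠ v := by
  rintro rfl
  exact he h.inc_left

lemma ne_right_of_isLink (h : G.IsLink e s t) (he : ¬ G.Inc e v) : t ≠ v :=
  ne_left_of_isLink h.symm he

lemma reduction_comm : G.reduction v a b = G.reduction v b a :=
  Graph.ext rfl fun e s t => by simp only [reduction]; grind

lemma reduction_isLink_some :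
    (G.reduction v a b).IsLink (some e) s t ↔ G.IsLink e s t ∧ s ≠ v ∧ t ≠ v := by
  simp [reduction]

lemma reduction_isLink_some_of_isLink (h : G.IsLink e s t) (he : ¬ G.Inc e v) :
    (G.reduction v a b).IsLink (some e) s t :=
  reduction_isLink_some.2 ⟨h, ne_left_of_isLink h he, ne_right_of_isLink h he⟩

lemma reduction_isLink_none (ha : a ∈ V(G)) (hav : a ≠ v) (hb : b ∈ V(G)) (hbv : b ≠ v) :
    (G.reduction v a b).IsLink none a b :=
  .inr ⟨rfl, ⟨ha, hav⟩, ⟨hb, hbv⟩, .inl ⟨rfl, rfl⟩⟩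

lemma some_mem_edgeSet_reduction :
    some e ∈ E(G.reduction v a b) ↔ e ∈ E(G) ∧ ¬ G.Inc e v := by
  constructor
  · intro h
    obtain ⟨s, t, h⟩ := exists_isLink_of_mem_edgeSet h
    obtain ⟨h, hs, ht⟩ := reduction_isLink_some.1 h
    exact ⟨h.edge_mem, fun hi => (hi.eq_or_eq_of_isLink h).elim (hs ·.symm) (ht ·.symm)⟩
  · rintro ⟨h, he⟩
    obtain ⟨s, t, h⟩ := exists_isLink_of_mem_edgeSet h
    exact (reduction_isLink_some_of_isLink h he).edge_mem

lemma some_image_sdiff : some '' A \ {some g} = some '' (A \ {g}) := by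
  rw [Set.image_sdiff (Option.some_injective β), Set.image_singleton]

lemma insert_none_sdiff_some :
    insert none (some '' A) \ {some g} = insert none (some '' (A \ {g})) := by
  rw [Set.insert_sdiff_of_notMem _ (by simp), some_image_sdiff]

lemma insert_none_sdiff_none : insert none (some '' A) \ {none} = some '' A :=
  Set.insert_sdiff_self_of_notMem (by simp)

namespace Avoids

lemma notMem (hA : Avoids G v A) (h : G.IsLink e v s) : e ∉ A := fun he => hA e he h.inc_left

lemma sdiff (hA : Avoids G v A) (B : Set β) : Avoids G v (A \ B) := fun e he => hA e he.1

lemma conn_reduction (hA : Avoids G v A) :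
    Conn (G.reduction v a b) (some '' A) p q ↔ Conn G A p q := by
  have : (fun s t => ∃ e ∈ some '' A, (G.reduction v a b).IsLink e s t) =
      fun s t => ∃ e ∈ A, G.IsLink e s t := by
    ext s t
    constructor
    · rintro ⟨_, ⟨e, he, rfl⟩, h⟩
      exact ⟨e, he, (reduction_isLink_some.1 h).1⟩
    · rintro ⟨e, he, h⟩
      exact ⟨some e, ⟨e, he, rfl⟩, reduction_isLink_some_of_isLink h (hA e he)⟩
  rw [Conn, Conn, this]

lemma not_conn (hA : Avoids G v A) (hq : q ≠ v) : ¬ Conn G A v q := by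
  intro h
  rcases Relation.ReflTransGen.cases_head h with rfl | ⟨m, ⟨e, he, hl⟩, -⟩
  · exact hq rfl
  · exact hA e he hl.inc_left

lemma conn_attach (hA : Avoids G v A) (h : G.IsLink e v c) (hp : p ≠ v) (hq : q ≠ v) :
    Conn G (insert e A) p q ↔ Conn G A p q := by
  rw [conn_insert_iff h]
  have hvq := hA.not_conn hq
  have hpv : ¬ Conn G A p v := fun h => hA.not_conn hp h.symm
  tauto

lemma conn_attach_left (hA : Avoids G v A) (h : G.IsLink e v c) (hq : q ≠ v) :
    Conn G (insert e A) v q ↔ Conn G A c q := by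
  rw [conn_insert_iff h]
  have hvq := hA.not_conn hq
  have hvv := Conn.refl G A v
  tauto

lemma conn_split (hA : Avoids G v A) (ha : G.IsLink ea v a) (hb : G.IsLink eb v b) (hav : a ≠ v)
    (hbv : b ≠ v) (hp : p ≠ v) (hq : q ≠ v) : Conn G (insert ea (insert eb A)) p q ↔
      Conn (G.reduction v a b) (insert none (some '' A)) p q := by
  rw [conn_insert_iff ha, conn_comm (s := p) (t := v), hA.conn_attach hb hp hq,
    hA.conn_attach hb hp hav, hA.conn_attach hb hav hq, hA.conn_attach_left hb hp,
    hA.conn_attach_left hb hq, conn_comm (s := b) (t := p),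
    conn_insert_iff (reduction_isLink_none ha.right_mem hav hb.right_mem hbv)]
  simp only [hA.conn_reduction]
  exact or_congr_right or_comm

lemma image_some_subset_edgeSet_iff (hA : Avoids G v A) :
    some '' A ⊆ E(G.reduction v a b) ↔ A ⊆ E(G) := by
  rw [Set.image_subset_iff]
  exact forall₂_congr fun e he => some_mem_edgeSet_reduction.trans (and_iff_left (hA e he))

lemma isForest_reduction_iff (hA : Avoids G v A) :
    IsForest (G.reduction v a b) (some '' A) ↔ IsForest G A := by
  simp only [IsForest, Set.forall_mem_image, some_image_sdiff, (hA.sdiff _).conn_reduction]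
  refine forall₂_congr fun e he => forall₂_congr fun s t => ?_
  exact ⟨fun h hst => h (reduction_isLink_some_of_isLink hst (hA e he)),
    fun h hst => h (reduction_isLink_some.1 hst).1⟩

end Avoids

lemma exists_mem_inc (hT : G.IsSpanningTree T) (h : G.IsLink e v t) (hne : t ≠ v) :
    ∃ f ∈ T, G.Inc f v := by
  by_contra! hT'
  exact Avoids.not_conn (A := T) hT' hne (hT.connects v h.left_mem t h.right_mem)

lemma connects_iff_of_isLink (h : G.IsLink e v c) (hcv : c ≠ v) (he : e ∈ A) : Connects G A ↔
    ∀ s ∈ V(G) \ {v}, ∀ t ∈ V(G) \ {v}, Conn G A s t := by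
  refine ⟨fun hA s hs t ht => hA s hs.1 t ht.1, fun hA s hs t ht => ?_⟩
  have hc : ∀ u ∈ V(G), Conn G A u c := fun u hu => by
    by_cases huv : u = v
    · exact huv ▸ conn_of_isLink h he
    · exact hA u ⟨hu, huv⟩ c ⟨h.right_mem, hcv⟩
  exact (hc s hs).trans (hc t ht).symm

lemma isSpanningTree_attach_iff (hB : Avoids G v B) (hc : G.IsLink ec v c) (hcv : c ≠ v) :
    G.IsSpanningTree (insert ec B) ↔ (G.reduction v a b).IsSpanningTree (some '' B) := by
  rw [isSpanningTree_iff, isSpanningTree_iff]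
  refine and_congr ?_ (and_congr ?_ (and_congr ?_ ?_))
  · rw [Set.insert_subset_iff, and_iff_right hc.edge_mem, hB.image_some_subset_edgeSet_iff]
  · exact iff_of_true ⟨c, hc.right_mem⟩ ⟨c, hc.right_mem, hcv⟩
  · rw [connects_iff_of_isLink hc hcv (Set.mem_insert _ _)]
    exact forall₄_congr fun s hs t ht => (hB.conn_attach hc hs.2 ht.2).trans hB.conn_reduction.symm
  · rw [isForest_insert_iff hc (hB.notMem hc), and_iff_left (hB.not_conn hcv),
      hB.isForest_reduction_iff]

lemma isSpanningTree_split_iff (hA : Avoids G v A) (ha : G.IsLink ea v a) (hb : G.IsLink eb v b)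
    (hav : a ≠ v) (hbv : b ≠ v) (hab : ea ≠ eb) : G.IsSpanningTree (insert ea (insert eb A)) ↔
      (G.reduction v a b).IsSpanningTree (insert none (some '' A)) := by
  have hn : (G.reduction v a b).IsLink none a b :=
    reduction_isLink_none ha.right_mem hav hb.right_mem hbv
  rw [isSpanningTree_iff, isSpanningTree_iff]
  refine and_congr ?_ (and_congr ?_ (and_congr ?_ ?_))
  · rw [Set.insert_subset_iff, Set.insert_subset_iff, Set.insert_subset_iff,
      and_iff_right ha.edge_mem, and_iff_right hb.edge_mem, and_iff_right hn.edge_mem,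
      hA.image_some_subset_edgeSet_iff]
  · exact iff_of_true ⟨a, ha.right_mem⟩ ⟨a, ha.right_mem, hav⟩
  · rw [connects_iff_of_isLink ha hav (Set.mem_insert _ _)]
    exact forall₄_congr fun s hs t ht => hA.conn_split ha hb hav hbv hs.2 ht.2
  · rw [isForest_insert_iff ha (by simp [hab, hA.notMem ha]), isForest_insert_iff hb (hA.notMem hb),
      isForest_insert_iff hn (by simp), and_iff_left (hA.not_conn hbv), hA.conn_attach_left hb hav,
      hA.isForest_reduction_iff, hA.conn_reduction, conn_comm (s := b)]

/-! ### Fundamental cuts of the reduction graph -/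

namespace Avoids

lemma mem_fundCut_attach_iff (hB : Avoids G v B) (hc : G.IsLink ec v c) (hg : g ≠ ec)
    (hf : f ∈ E(G)) (hfv : ¬ G.Inc f v) : f ∈ G.fundCut (insert ec B) g ↔
      some f ∈ (G.reduction v a b).fundCut (some '' B) (some g) := by
  obtain ⟨s, t, hl⟩ := exists_isLink_of_mem_edgeSet hf
  rw [mem_fundCut_iff hl, mem_fundCut_iff (reduction_isLink_some_of_isLink hl hfv),
    Set.insert_sdiff_of_notMem _ (by simpa using hg.symm), some_image_sdiff,
    (hB.sdiff _).conn_reduction,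
    (hB.sdiff _).conn_attach hc (ne_left_of_isLink hl hfv) (ne_right_of_isLink hl hfv)]

lemma mem_fundCut_split_iff (hA : Avoids G v A) (ha : G.IsLink ea v a) (hb : G.IsLink eb v b)
    (hav : a ≠ v) (hbv : b ≠ v) (hga : g ≠ ea) (hgb : g ≠ eb) (hf : f ∈ E(G))
    (hfv : ¬ G.Inc f v) : f ∈ G.fundCut (insert ea (insert eb A)) g ↔
      some f ∈ (G.reduction v a b).fundCut (insert none (some '' A)) (some g) := by
  obtain ⟨s, t, hl⟩ := exists_isLink_of_mem_edgeSet hf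
  rw [mem_fundCut_iff hl, mem_fundCut_iff (reduction_isLink_some_of_isLink hl hfv),
    Set.insert_sdiff_of_notMem _ (by simpa using hga.symm),
    Set.insert_sdiff_of_notMem _ (by simpa using hgb.symm), insert_none_sdiff_some,
    (hA.sdiff _).conn_split ha hb hav hbv (ne_left_of_isLink hl hfv) (ne_right_of_isLink hl hfv)]

lemma mem_fundCut_split_left_iff (hA : Avoids G v A) (ha : G.IsLink ea v a)
    (hb : G.IsLink eb v b) (hab : ea ≠ eb) (hf : f ∈ E(G)) (hfv : ¬ G.Inc f v) :
    f ∈ G.fundCut (insert ea (insert eb A)) ea ↔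
      some f ∈ (G.reduction v a b).fundCut (insert none (some '' A)) none := by
  obtain ⟨s, t, hl⟩ := exists_isLink_of_mem_edgeSet hf
  rw [mem_fundCut_iff hl, mem_fundCut_iff (reduction_isLink_some_of_isLink hl hfv),
    Set.insert_sdiff_self_of_notMem (by simp [hab, hA.notMem ha]), insert_none_sdiff_none,
    hA.conn_reduction, hA.conn_attach hb (ne_left_of_isLink hl hfv) (ne_right_of_isLink hl hfv)]

lemma mem_fundCut_attach_iff_not_conn (hB : Avoids G v B) (ha : G.IsLink ea v a)
    (hc : G.IsLink ec v c) (hav : a ≠ v) (hg : g ≠ ec) :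
    ea ∈ G.fundCut (insert ec B) g ↔ ¬ Conn G (B \ {g}) c a := by
  rw [mem_fundCut_iff ha, Set.insert_sdiff_of_notMem _ (by simpa using hg.symm),
    (hB.sdiff _).conn_attach_left hc hav]

end Avoids

/-! ### Lifting tree pairs -/

/-- `IsClaw G v a b c ea eb ec`: the edges at `v` are the three distinct edges `ea`, `eb`, `ec`,
none of them a loop, with the other ends `a`, `b`, `c`. Some of these ends may coincide. -/
structure IsClaw (G : Graph α β) (v a b c : α) (ea eb ec : β) : Prop where
  isLink_a : G.IsLink ea v a
  isLink_b : G.IsLink eb v b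
  isLink_c : G.IsLink ec v c
  a_ne : a ≠ v
  b_ne : b ≠ v
  c_ne : c ≠ v
  ea_ne_eb : ea ≠ eb
  ea_ne_ec : ea ≠ ec
  eb_ne_ec : eb ≠ ec
  eq_of_inc : ∀ e, G.Inc e v → e = ea ∨ e = eb ∨ e = ec

lemma IsClaw.swap (h : IsClaw G v a b c ea eb ec) : IsClaw G v b a c eb ea ec :=
  ⟨h.isLink_b, h.isLink_a, h.isLink_c, h.b_ne, h.a_ne, h.c_ne, h.ea_ne_eb.symm, h.eb_ne_ec,
    h.ea_ne_ec, fun e he => or_left_comm.1 (h.eq_of_inc e he)⟩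

lemma IsClaw.inc_iff (h : IsClaw G v a b c ea eb ec) : G.Inc e v ↔ e = ea ∨ e = eb ∨ e = ec := by
  refine ⟨h.eq_of_inc e, ?_⟩
  rintro (rfl | rfl | rfl)
  exacts [h.isLink_a.inc_left, h.isLink_b.inc_left, h.isLink_c.inc_left]

lemma IsClaw.mem_edgeSet_iff (h : IsClaw G v a b c ea eb ec) : e ∈ E(G) ↔
    (e = ea ∨ e = eb ∨ e = ec) ∨ some e ∈ E(G.reduction v a b) := by
  rw [some_mem_edgeSet_reduction, ← h.inc_iff, or_and_left, and_iff_left (em _)]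
  exact ⟨.inr, fun he => he.elim (fun hi => hi.edge_mem) id⟩

lemma IsClaw.isTreePair_iff (h : IsClaw G v a b c ea eb ec) (hA : Avoids G v A)
    (hB : Avoids G v B) : G.IsTreePair (insert ea (insert eb A)) (insert ec B) ↔
      (G.reduction v a b).IsTreePair (insert none (some '' A)) (some '' B) := by
  have hleft := isSpanningTree_split_iff hA h.isLink_a h.isLink_b h.a_ne h.b_ne h.ea_ne_eb
  have hright := isSpanningTree_attach_iff (a := a) (b := b) hB h.isLink_c h.c_ne
  have hdisj : Disjoint (insert ea (insert eb A)) (insert ec B) ↔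
      Disjoint (insert none (some '' A)) (some '' B) := by
    have := h.ea_ne_ec
    have := h.eb_ne_ec
    have := hA.notMem h.isLink_c
    have := hB.notMem h.isLink_a
    have := hB.notMem h.isLink_b
    simp only [Set.disjoint_insert_left, Set.disjoint_insert_right, Set.mem_insert_iff,
      Set.disjoint_image_iff (Option.some_injective β)]
    grind
  have hunion : insert ea (insert eb A) ∪ insert ec B = E(G) ↔
      insert none (some '' A) ∪ some '' B = E(G.reduction v a b) := by
    have hnone : none ∈ E(G.reduction v a b) :=
      (reduction_isLink_none h.isLink_a.right_mem h.a_ne h.isLink_b.right_mem h.b_ne).edge_mem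
    have hsome : ∀ e, some e ∈ E(G.reduction v a b) → ¬ (e = ea ∨ e = eb ∨ e = ec) :=
      fun e he => h.inc_iff.not.1 (some_mem_edgeSet_reduction.1 he).2
    have hAv := fun e he => h.inc_iff.not.1 (hA e he)
    have hBv := fun e he => h.inc_iff.not.1 (hB e he)
    simp only [Set.ext_iff, Option.forall, h.mem_edgeSet_iff, Set.mem_union, Set.mem_insert_iff,
      (Option.some_injective β).mem_set_image, hnone]
    grind
  exact ⟨fun hp => ⟨hleft.1 hp.1, hright.1 hp.2, hdisj.1 hp.3, hunion.1 hp.4⟩,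
    fun hp => ⟨hleft.2 hp.1, hright.2 hp.2, hdisj.2 hp.3, hunion.2 hp.4⟩⟩

lemma rho_insert_none_image : rho ea eb ec (insert none (some '' A)) (some '' B) =
    (insert ea (insert eb A), insert ec B) := by
  ext e <;> simp [rho]

lemma rho_image_insert_none : rho ea eb ec (some '' B) (insert none (some '' A)) =
    (insert ec B, insert ea (insert eb A)) := by
  ext e <;> simp [rho]

/-- `IsLift G v a b c ea eb ec A B`: the sets `A + ea + eb` and `B + ec` form a tree pair, where
`ea`, `eb`, `ec` are the edges at `v` and `A`, `B` avoid `v`. It is the lift of the tree pair formed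
by `A + e_{a,b}` and `B` in the reduction graph (`IsLift.reduction`). -/
structure IsLift (G : Graph α β) (v a b c : α) (ea eb ec : β) (A B : Set β) : Prop where
  isClaw : IsClaw G v a b c ea eb ec
  left_avoids : Avoids G v A
  right_avoids : Avoids G v B
  isTreePair : G.IsTreePair (insert ea (insert eb A)) (insert ec B)

namespace IsLift

lemma swap (h : IsLift G v a b c ea eb ec A B) : IsLift G v b a c eb ea ec A B :=
  ⟨h.isClaw.swap, h.left_avoids, h.right_avoids, Set.insert_comm ea eb A ▸ h.isTreePair⟩

lemma reduction (h : IsLift G v a b c ea eb ec A B) :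
    (G.reduction v a b).IsTreePair (insert none (some '' A)) (some '' B) :=
  (h.isClaw.isTreePair_iff h.left_avoids h.right_avoids).1 h.isTreePair

lemma mem_left_iff (h : IsLift G v a b c ea eb ec A B) (he : ¬ G.Inc e v) :
    e ∈ insert ea (insert eb A) ↔ e ∈ A := by
  rw [h.isClaw.inc_iff] at he
  grind

lemma mem_right_iff (h : IsLift G v a b c ea eb ec A B) (he : ¬ G.Inc e v) :
    e ∈ insert ec B ↔ e ∈ B := by
  rw [h.isClaw.inc_iff] at he
  grind

/-! ### Partners in a lifted tree pair -/

lemma canExchange_some_iff (h : IsLift G v a b c ea eb ec A B) (he : e ∈ A) (hf : f ∈ B) :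
    CanExchange G (insert ea (insert eb A)) (insert ec B) e f ↔
      CanExchange (G.reduction v a b) (insert none (some '' A)) (some '' B) (some e) (some f) := by
  have hev := h.left_avoids e he
  have hfv := h.right_avoids f hf
  have heE := h.isTreePair.left.1 (.inr (.inr he))
  have hfE := h.isTreePair.right.1 (.inr hf)
  obtain ⟨hea, heb, -⟩ := by simpa only [not_or] using h.isClaw.inc_iff.not.1 hev
  obtain ⟨-, -, hfc⟩ := by simpa only [not_or] using h.isClaw.inc_iff.not.1 hfv
  exact and_congr (h.left_avoids.mem_fundCut_split_iff h.isClaw.isLink_a h.isClaw.isLink_b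
    h.isClaw.a_ne h.isClaw.b_ne hea heb hfE hfv)
    (h.right_avoids.mem_fundCut_attach_iff h.isClaw.isLink_c hfc heE hev)

lemma canExchange_left_iff (h : IsLift G v a b c ea eb ec A B) (hg : g ∈ B) :
    CanExchange G (insert ea (insert eb A)) (insert ec B) ea g ↔
      some g ∈ (G.reduction v a b).fundCut (insert none (some '' A)) none ∧
        ea ∈ G.fundCut (insert ec B) g :=
  and_congr_left' (h.left_avoids.mem_fundCut_split_left_iff h.isClaw.isLink_a h.isClaw.isLink_b
    h.isClaw.ea_ne_eb (h.isTreePair.right.1 (.inr hg)) (h.right_avoids g hg))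

lemma canExchange_right_iff (h : IsLift G v a b c ea eb ec A B) (hg : g ∈ B) :
    CanExchange G (insert ea (insert eb A)) (insert ec B) eb g ↔
      some g ∈ (G.reduction v a b).fundCut (insert none (some '' A)) none ∧
        eb ∈ G.fundCut (insert ec B) g := by
  rw [Set.insert_comm, reduction_comm]
  exact h.swap.canExchange_left_iff hg

/-- The ends `a` and `b` of the split edge are separated by `B - g`, which has two components, if
and only if exactly one of them is separated from `c`. -/
lemma canExchange_none_iff (h : IsLift G v a b c ea eb ec A B) (hg : g ∈ B) :
    CanExchange (G.reduction v a b) (insert none (some '' A)) (some '' B) none (some g) ↔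
      some g ∈ (G.reduction v a b).fundCut (insert none (some '' A)) none ∧
        Xor (ea ∈ G.fundCut (insert ec B) g) (eb ∈ G.fundCut (insert ec B) g) := by
  obtain ⟨ha, hb, hc, hav, hbv, hcv, -⟩ := h.isClaw
  have hB := h.right_avoids.sdiff {g}
  have hgc : g ≠ ec := fun hgc => h.right_avoids.notMem hc (hgc ▸ hg)
  have hsep : ∀ {p q r}, p ∈ V(G) → p ≠ v → q ∈ V(G) → q ≠ v → r ∈ V(G) → r ≠ v →
      ¬ Conn G (B \ {g}) p q → ¬ Conn G (B \ {g}) q r → Conn G (B \ {g}) p r := by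
    intro p q r hp hpv hq hqv hr hrv
    have := h.reduction.right.conn_of_not_conn (Set.mem_image_of_mem _ hg) ⟨hp, hpv⟩ ⟨hq, hqv⟩
      ⟨hr, hrv⟩
    rwa [some_image_sdiff, hB.conn_reduction, hB.conn_reduction, hB.conn_reduction] at this
  have := hsep ha.right_mem hav hc.right_mem hcv hb.right_mem hbv
  refine and_congr_right fun _ => ?_
  rw [mem_fundCut_iff (reduction_isLink_none ha.right_mem hav hb.right_mem hbv), some_image_sdiff,
    hB.conn_reduction, h.right_avoids.mem_fundCut_attach_iff_not_conn ha hc hav hgc,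
    h.right_avoids.mem_fundCut_attach_iff_not_conn hb hc hbv hgc]
  rw [Xor]
  grind [Conn.symm, Conn.trans]

lemma mem_fundCut_attach_iff_inc (h : IsLift G v a b c ea eb ec A B) (hf : f ∈ E(G)) :
    f ∈ G.fundCut (insert ec B) ec ↔ G.Inc f v := by
  have hloop : ∀ e p, G.IsLink e v p → p ≠ v := by
    intro e p hp
    rcases h.isClaw.eq_of_inc e hp.inc_left with rfl | rfl | rfl
    · exact hp.right_unique h.isClaw.isLink_a ▸ h.isClaw.a_ne
    · exact hp.right_unique h.isClaw.isLink_b ▸ h.isClaw.b_ne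
    · exact hp.right_unique h.isClaw.isLink_c ▸ h.isClaw.c_ne
  by_cases hfv : G.Inc f v
  · obtain ⟨p, hp⟩ := hfv
    rw [mem_fundCut_iff hp, Set.insert_sdiff_self_of_notMem
      (h.right_avoids.notMem h.isClaw.isLink_c)]
    exact iff_of_true (h.right_avoids.not_conn (hloop f p hp)) hp.inc_left
  · obtain ⟨s, t, hst⟩ := exists_isLink_of_mem_edgeSet hf
    rw [mem_fundCut_iff hst, Set.insert_sdiff_self_of_notMem
      (h.right_avoids.notMem h.isClaw.isLink_c)]
    refine iff_of_false (not_not.2 ?_) hfv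
    exact h.right_avoids.conn_reduction.1 (h.reduction.right.connects
      s ⟨hst.left_mem, ne_left_of_isLink hst hfv⟩ t ⟨hst.right_mem, ne_right_of_isLink hst hfv⟩)

lemma canExchange_attach_iff (h : IsLift G v a b c ea eb ec A B)
    (hf : f ∈ insert ea (insert eb A)) :
    CanExchange G (insert ea (insert eb A)) (insert ec B) f ec ↔
      G.Inc f v ∧ f ∈ G.fundCycle (insert ea (insert eb A)) ec := by
  have hec : ec ∈ insert ec B := Set.mem_insert _ _
  rw [h.isTreePair.left.mem_fundCycle_iff_mem_fundCut hf (h.isTreePair.right.1 hec)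
    (h.isTreePair.notMem_left hec), CanExchange, and_comm,
    h.mem_fundCut_attach_iff_inc (h.isTreePair.left.1 hf)]

lemma mem_fundCycle_attach_iff (h : IsLift G v a b c ea eb ec A B) :
    ea ∈ G.fundCycle (insert ea (insert eb A)) ec ↔ ¬ Conn G A b c := by
  have hA := h.left_avoids
  have hec : ec ∈ insert ec B := Set.mem_insert _ _
  rw [h.isTreePair.left.mem_fundCycle_iff_mem_fundCut (Set.mem_insert _ _)
    (h.isTreePair.right.1 hec) (h.isTreePair.notMem_left hec), mem_fundCut_iff h.isClaw.isLink_c,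
    Set.insert_sdiff_self_of_notMem (by simp [h.isClaw.ea_ne_eb, hA.notMem h.isClaw.isLink_a]),
    hA.conn_attach_left h.isClaw.isLink_b h.isClaw.c_ne]

/-- The split edge joins the two components of `A`, and `c` belongs to one of them. -/
lemma xor_mem_fundCycle_attach (h : IsLift G v a b c ea eb ec A B) :
    Xor (ea ∈ G.fundCycle (insert ea (insert eb A)) ec)
      (eb ∈ G.fundCycle (insert ea (insert eb A)) ec) := by
  obtain ⟨ha, hb, hc, hav, hbv, hcv, -⟩ := h.isClaw
  have hnone := reduction_isLink_none ha.right_mem hav hb.right_mem hbv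
  have hmem : none ∈ insert none (some '' A) := Set.mem_insert _ _
  have hab := h.reduction.left.isForest none hmem a b hnone
  have hor := h.reduction.left.conn_or_conn hmem hnone (p := c) ⟨hc.right_mem, hcv⟩
  simp only [insert_none_sdiff_none, h.left_avoids.conn_reduction] at hab hor
  have hright := h.swap.mem_fundCycle_attach_iff
  rw [Set.insert_comm] at hright
  rw [h.mem_fundCycle_attach_iff, hright, Xor]
  grind [Conn.symm, Conn.trans]

/-! ### Unique exchanges of a lifted tree pair -/

lemma isUniqueExchange_left_iff (h : IsLift G v a b c ea eb ec A B) (he : e ∈ A) (hf : f ∈ B) :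
    G.IsUniqueExchange (insert ea (insert eb A)) (insert ec B) e f ↔
      (G.reduction v a b).IsUniqueExchange (insert none (some '' A)) (some '' B)
        (some e) (some f) := by
  have hec : ¬ CanExchange G (insert ea (insert eb A)) (insert ec B) e ec := by
    rw [h.canExchange_attach_iff (.inr (.inr he))]
    exact fun he' => h.left_avoids e he he'.1
  have hfc : ec ≠ f := fun hfc => h.right_avoids.notMem h.isClaw.isLink_c (hfc ▸ hf)
  have hsome := fun f' (hf' : f' ∈ B) => h.canExchange_some_iff he hf'
  simp only [h.isTreePair.isUniqueExchange_iff, h.reduction.isUniqueExchange_iff,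
    Set.forall_mem_insert, Set.forall_mem_image, (Option.some_injective β).mem_set_image]
  grind

lemma isUniqueExchange_right_iff (h : IsLift G v a b c ea eb ec A B) (he : e ∈ B) (hf : f ∈ A) :
    G.IsUniqueExchange (insert ec B) (insert ea (insert eb A)) e f ↔
      (G.reduction v a b).IsUniqueExchange (some '' B) (insert none (some '' A))
        (some e) (some f) ∧
      ¬ (some e ∈ (G.reduction v a b).fundCut (insert none (some '' A)) none ∧
        ea ∈ G.fundCut (insert ec B) e ∧ eb ∈ G.fundCut (insert ec B) e) := by
  have hfa : ea ≠ f := fun hfa => h.left_avoids.notMem h.isClaw.isLink_a (hfa ▸ hf)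
  have hfb : eb ≠ f := fun hfb => h.left_avoids.notMem h.isClaw.isLink_b (hfb ▸ hf)
  have hsome := fun f' (hf' : f' ∈ A) => h.canExchange_some_iff hf' he
  simp only [h.isTreePair.symm.isUniqueExchange_iff, h.reduction.symm.isUniqueExchange_iff,
    canExchange_comm (S := insert ec B), canExchange_comm (S := some '' B),
    Set.forall_mem_insert, Set.forall_mem_image, (Option.some_injective β).mem_set_image,
    h.canExchange_left_iff he, h.canExchange_right_iff he, h.canExchange_none_iff he, Xor]
  grind

lemma isUniqueExchange_split_iff (h : IsLift G v a b c ea eb ec A B) (he : e ∈ B) :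
    G.IsUniqueExchange (insert ec B) (insert ea (insert eb A)) e ea ↔
      (G.reduction v a b).IsUniqueExchange (some '' B) (insert none (some '' A)) (some e) none ∧
        ea ∈ G.fundCut (insert ec B) e := by
  have hab := h.isClaw.ea_ne_eb
  have haA := h.left_avoids.notMem h.isClaw.isLink_a
  have hsome := fun f' (hf' : f' ∈ A) => h.canExchange_some_iff hf' he
  simp only [h.isTreePair.symm.isUniqueExchange_iff, h.reduction.symm.isUniqueExchange_iff,
    canExchange_comm (S := insert ec B), canExchange_comm (S := some '' B),
    Set.forall_mem_insert, Set.forall_mem_image, (Option.some_injective β).mem_set_image,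
    h.canExchange_left_iff he, h.canExchange_right_iff he, h.canExchange_none_iff he, Xor]
  grind

lemma isUniqueExchange_none_iff (h : IsLift G v a b c ea eb ec A B) (he : e ∈ B)
    (hf : f = ea ∨ f = eb) :
    G.IsUniqueExchange (insert ec B) (insert ea (insert eb A)) e f ↔
      (G.reduction v a b).IsUniqueExchange (some '' B) (insert none (some '' A)) (some e) none ∧
        f ∈ G.fundCut (insert ec B) e := by
  rcases hf with rfl | rfl
  · exact h.isUniqueExchange_split_iff he
  · rw [Set.insert_comm, reduction_comm]
    exact h.swap.isUniqueExchange_split_iff he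

lemma notBroken_of_mem_left (h : IsLift G v a b c ea eb ec A B) (he : e ∈ A) :
    G.NotBroken (G.reduction v a b) ea eb ec e (insert none (some '' A)) (some '' B) := by
  refine .inl ⟨Set.mem_insert _ _, fun hcut => ?_⟩
  have hmem : some e ∈ insert none (some '' A) := .inr (Set.mem_image_of_mem _ he)
  exact Option.some_ne_none e (h.reduction.left.eq_of_mem_fundCut hmem hcut.1)

lemma notBroken_iff_of_mem_right (h : IsLift G v a b c ea eb ec A B) (he : e ∈ B) :
    G.NotBroken (G.reduction v a b) ea eb ec e (insert none (some '' A)) (some '' B) ↔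
      ¬ (some e ∈ (G.reduction v a b).fundCut (insert none (some '' A)) none ∧
        ea ∈ G.fundCut (insert ec B) e ∧ eb ∈ G.fundCut (insert ec B) e) := by
  have hT := h.isTreePair.right
  have heT : e ∈ insert ec B := .inr he
  have hea : ea ∈ insert ea (insert eb A) := .inl rfl
  have heb : eb ∈ insert ea (insert eb A) := .inr (.inl rfl)
  rw [← hT.mem_fundCycle_iff_mem_fundCut heT (h.isTreePair.left.1 hea)
    (h.isTreePair.notMem_right hea), ← hT.mem_fundCycle_iff_mem_fundCut heT
    (h.isTreePair.left.1 heb) (h.isTreePair.notMem_right heb)]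
  simp [NotBroken, Set.preimage_image_eq _ (Option.some_injective β)]

lemma isTauArc_some_iff (h : IsLift G v a b c ea eb ec A B) (he : ¬ G.Inc e v)
    (hf : ¬ G.Inc f v) : G.IsTauArc e f (insert ea (insert eb A)) (insert ec B) ↔
      (G.reduction v a b).IsTauArc (some e) (some f) (insert none (some '' A)) (some '' B) ∧
        G.NotBroken (G.reduction v a b) ea eb ec e (insert none (some '' A)) (some '' B) := by
  constructor
  · rintro ⟨-, hu | hu⟩
    · have heA := (h.mem_left_iff he).1 hu.1
      have hfB := (h.mem_right_iff hf).1 hu.2.1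
      exact ⟨⟨h.reduction, .inl ((h.isUniqueExchange_left_iff heA hfB).1 hu)⟩,
        h.notBroken_of_mem_left heA⟩
    · have heB := (h.mem_right_iff he).1 hu.1
      have hfA := (h.mem_left_iff hf).1 hu.2.1
      obtain ⟨hu, hn⟩ := (h.isUniqueExchange_right_iff heB hfA).1 hu
      exact ⟨⟨h.reduction, .inr hu⟩, (h.notBroken_iff_of_mem_right heB).2 hn⟩
  · rintro ⟨⟨-, hu | hu⟩, hn⟩
    · have heA : e ∈ A := by simpa using hu.1
      have hfB : f ∈ B := by simpa using hu.2.1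
      exact ⟨h.isTreePair, .inl ((h.isUniqueExchange_left_iff heA hfB).2 hu)⟩
    · have heB : e ∈ B := by simpa using hu.1
      have hfA : f ∈ A := by simpa using hu.2.1
      rw [h.notBroken_iff_of_mem_right heB] at hn
      exact ⟨h.isTreePair, .inr ((h.isUniqueExchange_right_iff heB hfA).2 ⟨hu, hn⟩)⟩

lemma isForwardEdge_iff (h : IsLift G v a b c ea eb ec A B) (he : e ∈ B) :
    G.IsForwardEdge ea eb ec e (insert none (some '' A)) (some '' B) f ↔
      (f = ea ∨ f = eb) ∧ f ∈ G.fundCut (insert ec B) e := by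
  rw [IsForwardEdge, rho_insert_none_image, h.isTreePair.pairCut_right (.inr he)]

lemma isTauArc_none_iff (h : IsLift G v a b c ea eb ec A B) (he : ¬ G.Inc e v)
    (hf : G.Inc f v) : G.IsTauArc e f (insert ea (insert eb A)) (insert ec B) ↔
      (G.reduction v a b).IsTauArc (some e) none (insert none (some '' A)) (some '' B) ∧
        G.IsForwardEdge ea eb ec e (insert none (some '' A)) (some '' B) f := by
  constructor
  · rintro ⟨-, hu | hu⟩
    · have hfc : f = ec := hu.2.1.resolve_right fun hfB => h.right_avoids f hfB hf
      have hcan := ((h.isTreePair.isUniqueExchange_iff).1 hu).2.2 f hu.2.1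
      rw [hfc, h.canExchange_attach_iff hu.1] at hcan
      exact absurd (hcan.2 rfl).1 he
    · have heB := (h.mem_right_iff he).1 hu.1
      have hfab : f = ea ∨ f = eb := by
        have hfA : f ∉ A := fun hfA => h.left_avoids f hfA hf
        simpa [hfA] using hu.2.1
      obtain ⟨hu, hcut⟩ := (h.isUniqueExchange_none_iff heB hfab).1 hu
      exact ⟨⟨h.reduction, .inr hu⟩, (h.isForwardEdge_iff heB).2 ⟨hfab, hcut⟩⟩
  · rintro ⟨⟨-, hu | hu⟩, hfwd⟩
    · simpa using hu.2.1
    · have heB : e ∈ B := by simpa using hu.1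
      obtain ⟨hfab, hcut⟩ := (h.isForwardEdge_iff heB).1 hfwd
      exact ⟨h.isTreePair, .inr ((h.isUniqueExchange_none_iff heB hfab).2 ⟨hu, hcut⟩)⟩

lemma existsUnique_isForwardEdge (h : IsLift G v a b c ea eb ec A B)
    (harc : (G.reduction v a b).IsTauArc (some e) none (insert none (some '' A)) (some '' B)) :
    ∃! f, G.IsForwardEdge ea eb ec e (insert none (some '' A)) (some '' B) f := by
  obtain ⟨-, hu | hu⟩ := harc
  · simpa using hu.2.1
  · have heB : e ∈ B := by simpa using hu.1
    have hcan := ((h.reduction.symm.isUniqueExchange_iff).1 hu).2.2 none hu.2.1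
    rw [canExchange_comm, h.canExchange_none_iff heB] at hcan
    simp only [h.isForwardEdge_iff heB]
    rcases (hcan.2 rfl).2 with ⟨hin, hout⟩ | ⟨hin, hout⟩
    · exact ⟨ea, ⟨.inl rfl, hin⟩, by rintro _ ⟨rfl | rfl, hf⟩ <;> tauto⟩
    · exact ⟨eb, ⟨.inr rfl, hin⟩, by rintro _ ⟨rfl | rfl, hf⟩ <;> tauto⟩

end IsLift

/-! ### Unique exchanges and the map `rho` -/

lemma isForwardEdge_comm : G.IsForwardEdge ea eb ec g (some '' B) (insert none (some '' A)) f ↔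
    G.IsForwardEdge ea eb ec g (insert none (some '' A)) (some '' B) f := by
  simp only [IsForwardEdge, rho_insert_none_image, rho_image_insert_none, pairCut, or_comm]

lemma notBroken_comm {H : Graph α (Option β)} {S₀ T₀ : Set (Option β)} :
    G.NotBroken H ea eb ec e S₀ T₀ ↔ G.NotBroken H ea eb ec e T₀ S₀ :=
  or_comm

namespace IsClaw

variable {S₀ T₀ : Set (Option β)}

lemma exists_isLift_of_none_mem (h : IsClaw G v a b c ea eb ec)
    (hp : (G.reduction v a b).IsTreePair S₀ T₀) (hn : none ∈ S₀) :
    ∃ A B, IsLift G v a b c ea eb ec A B ∧ S₀ = insert none (some '' A) ∧ T₀ = some '' B := by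
  have hS₀ : S₀ = insert none (some '' (some ⁻¹' S₀)) := by
    ext (_ | e) <;> simp [hn]
  have hT₀ : T₀ = some '' (some ⁻¹' T₀) := by
    ext (_ | e) <;> simp [hp.notMem_right hn]
  have hA : Avoids G v (some ⁻¹' S₀) :=
    fun e he => (some_mem_edgeSet_reduction.1 (hp.left.1 he)).2
  have hB : Avoids G v (some ⁻¹' T₀) :=
    fun e he => (some_mem_edgeSet_reduction.1 (hp.right.1 he)).2
  exact ⟨_, _, ⟨h, hA, hB, (h.isTreePair_iff hA hB).2 (hS₀ ▸ hT₀ ▸ hp)⟩, hS₀, hT₀⟩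

lemma exists_isLift_reduction (h : IsClaw G v a b c ea eb ec)
    (hp : (G.reduction v a b).IsTreePair S₀ T₀) : ∃ A B, IsLift G v a b c ea eb ec A B ∧
      (S₀ = insert none (some '' A) ∧ T₀ = some '' B ∨
        S₀ = some '' B ∧ T₀ = insert none (some '' A)) := by
  have hnone := reduction_isLink_none h.isLink_a.right_mem h.a_ne h.isLink_b.right_mem h.b_ne
  rcases hp.mem_or_mem hnone.edge_mem with hn | hn
  · obtain ⟨A, B, hlift, hS₀, hT₀⟩ := h.exists_isLift_of_none_mem hp hn
    exact ⟨A, B, hlift, .inl ⟨hS₀, hT₀⟩⟩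
  · obtain ⟨A, B, hlift, hT₀, hS₀⟩ := h.exists_isLift_of_none_mem hp.symm hn
    exact ⟨A, B, hlift, .inr ⟨hS₀, hT₀⟩⟩

lemma isTauArc_rho_some_iff (h : IsClaw G v a b c ea eb ec)
    (hp : (G.reduction v a b).IsTreePair S₀ T₀) (he : ¬ G.Inc e v) (hf : ¬ G.Inc f v) :
    G.IsTauArc e f (rho ea eb ec S₀ T₀).1 (rho ea eb ec S₀ T₀).2 ↔
      (G.reduction v a b).IsTauArc (some e) (some f) S₀ T₀ ∧
        G.NotBroken (G.reduction v a b) ea eb ec e S₀ T₀ := by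
  obtain ⟨A, B, hlift, ⟨rfl, rfl⟩ | ⟨rfl, rfl⟩⟩ := h.exists_isLift_reduction hp
  · rw [rho_insert_none_image]
    exact hlift.isTauArc_some_iff he hf
  · rw [rho_image_insert_none, isTauArc_comm, notBroken_comm,
      isTauArc_comm (G := G.reduction v a b)]
    exact hlift.isTauArc_some_iff he hf

lemma isTauArc_rho_none_iff (h : IsClaw G v a b c ea eb ec)
    (hp : (G.reduction v a b).IsTreePair S₀ T₀) (he : ¬ G.Inc e v) (hf : G.Inc f v) :
    G.IsTauArc e f (rho ea eb ec S₀ T₀).1 (rho ea eb ec S₀ T₀).2 ↔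
      (G.reduction v a b).IsTauArc (some e) none S₀ T₀ ∧
        G.IsForwardEdge ea eb ec e S₀ T₀ f := by
  obtain ⟨A, B, hlift, ⟨rfl, rfl⟩ | ⟨rfl, rfl⟩⟩ := h.exists_isLift_reduction hp
  · rw [rho_insert_none_image]
    exact hlift.isTauArc_none_iff he hf
  · rw [rho_image_insert_none, isTauArc_comm, isForwardEdge_comm,
      isTauArc_comm (G := G.reduction v a b)]
    exact hlift.isTauArc_none_iff he hf

lemma existsUnique_isForwardEdge (h : IsClaw G v a b c ea eb ec)
    (harc : (G.reduction v a b).IsTauArc (some g) none S₀ T₀) :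
    ∃! f, G.IsForwardEdge ea eb ec g S₀ T₀ f := by
  obtain ⟨A, B, hlift, ⟨rfl, rfl⟩ | ⟨rfl, rfl⟩⟩ := h.exists_isLift_reduction harc.1
  · exact hlift.existsUnique_isForwardEdge harc
  · simp only [isForwardEdge_comm]
    exact hlift.existsUnique_isForwardEdge (isTauArc_comm.1 harc)

end IsClaw

lemma hasRoles_comm : G.HasRoles ea eb ec S T ↔ G.HasRoles ea eb ec T S := by
  have hcycle : G.pairCycle S T ec = G.pairCycle T S ec := Set.ext fun _ => or_comm
  rw [HasRoles, HasRoles, hcycle, or_comm (a := ea ∈ S ∧ _)]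
  exact and_congr_left' ⟨IsTreePair.symm, IsTreePair.symm⟩

lemma pairCut_inter_pairCycle_eq_iff (hp : G.IsTreePair S T) (he : e ∈ S) (hf : f ∈ T) :
    G.pairCut S T e ∩ G.pairCycle S T e = {e, f} ↔ G.IsUniqueExchange S T e f := by
  rw [hp.pairCut_left he, hp.pairCycle_left he, hp.fundCut_inter_fundCycle_eq_iff he hf]

namespace IsLift

lemma hasRoles_iff (h : IsLift G v a b c ea eb ec A B) :
    G.HasRoles ea eb ec (insert ea (insert eb A)) (insert ec B) ↔
      ea ∈ G.fundCycle (insert ea (insert eb A)) ec := by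
  have hxor := h.xor_mem_fundCycle_attach
  rw [HasRoles, h.isTreePair.pairCycle_right (Set.mem_insert _ _)]
  simp only [h.isTreePair, Set.mem_insert_iff, true_or, or_true, true_and]
  rw [Xor] at hxor
  tauto

lemma hasRoles_or_hasRoles (h : IsLift G v a b c ea eb ec A B) :
    G.HasRoles ea eb ec (insert ea (insert eb A)) (insert ec B) ∨
      G.HasRoles eb ea ec (insert ea (insert eb A)) (insert ec B) := by
  have hswap := h.swap.hasRoles_iff
  rw [Set.insert_comm] at hswap
  rw [h.hasRoles_iff, hswap]
  exact h.xor_mem_fundCycle_attach.or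

/-- The cut of the attachment edge consists of the edges at `v`, so its only partner is the
cycle edge. -/
lemma canExchange_attach_iff_eq (h : IsLift G v a b c ea eb ec A B)
    (hcycle : ea ∈ G.fundCycle (insert ea (insert eb A)) ec)
    (hf : f ∈ insert ea (insert eb A)) :
    CanExchange G (insert ea (insert eb A)) (insert ec B) f ec ↔ f = ea := by
  have hxor := h.xor_mem_fundCycle_attach
  have hfc := h.isTreePair.ne hf (Set.mem_insert ec B)
  rw [h.canExchange_attach_iff hf, h.isClaw.inc_iff]
  rw [Xor] at hxor
  grind

lemma isTauArc_inc_iff (h : IsLift G v a b c ea eb ec A B)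
    (hcycle : ea ∈ G.fundCycle (insert ea (insert eb A)) ec) (he : G.Inc e v) (hf : G.Inc f v) :
    G.IsTauArc e f (insert ea (insert eb A)) (insert ec B) ↔ (e = ec ∧ f = ea) ∨
      (e = ea ∧ f = ec ∧
        G.IsUniqueExchange (insert ea (insert eb A)) (insert ec B) ea ec) := by
  have hea : ea ∈ insert ea (insert eb A) := Set.mem_insert _ _
  have hec : ec ∈ insert ec B := Set.mem_insert _ _
  have heq : ∀ g ∈ insert ec B, G.Inc g v → g = ec :=
    fun g hg hgv => hg.resolve_right fun hgB => h.right_avoids g hgB hgv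
  constructor
  · rintro ⟨-, hu | hu⟩
    · obtain rfl := heq f hu.2.1 hf
      have hcan := ((h.isTreePair.isUniqueExchange_iff.1 hu).2.2 f hec).2 rfl
      obtain rfl := (h.canExchange_attach_iff_eq hcycle hu.1).1 hcan
      exact .inr ⟨rfl, rfl, hu⟩
    · obtain rfl := heq e hu.1 he
      have hcan := ((h.isTreePair.symm.isUniqueExchange_iff.1 hu).2.2 f hu.2.1).2 rfl
      exact .inl ⟨rfl, (h.canExchange_attach_iff_eq hcycle hu.2.1).1 (canExchange_comm.1 hcan)⟩
  · rintro (⟨rfl, rfl⟩ | ⟨rfl, rfl, hu⟩)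
    · refine ⟨h.isTreePair, .inr ((h.isTreePair.symm.isUniqueExchange_iff).2 ⟨hec, hea, ?_⟩)⟩
      exact fun g hg => canExchange_comm.trans (h.canExchange_attach_iff_eq hcycle hg)
    · exact ⟨h.isTreePair, .inl hu⟩

end IsLift

namespace IsClaw

lemma exists_isLift_of_mem (h : IsClaw G v a b c ea eb ec) (hp : G.IsTreePair S T) (hea : ea ∈ S)
    (heb : eb ∈ S) (hec : ec ∈ T) : ∃ A B, IsLift G v a b c ea eb ec A B ∧
      S = insert ea (insert eb A) ∧ T = insert ec B := by
  have hS : S = insert ea (insert eb (S \ {ea, eb})) := by grind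
  have hT : T = insert ec (T \ {ec}) := by grind
  have hecS := hp.notMem_left hec
  have heaT := hp.notMem_right hea
  have hebT := hp.notMem_right heb
  refine ⟨_, _, ⟨h, fun e he hi => ?_, fun e he hi => ?_, hS ▸ hT ▸ hp⟩, hS, hT⟩
  · grind [h.inc_iff.1 hi]
  · grind [h.inc_iff.1 hi]

lemma exists_isLift_of_hasRoles (h : IsClaw G v a b c ea eb ec) (hr : G.HasRoles ea eb ec S T) :
    ∃ A B, IsLift G v a b c ea eb ec A B ∧ ea ∈ G.fundCycle (insert ea (insert eb A)) ec ∧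
      (S = insert ea (insert eb A) ∧ T = insert ec B ∨
        S = insert ec B ∧ T = insert ea (insert eb A)) := by
  obtain ⟨hp, ⟨hea, heb, hec⟩ | ⟨hea, heb, hec⟩, -⟩ := id hr
  · obtain ⟨A, B, hlift, rfl, rfl⟩ := h.exists_isLift_of_mem hp hea heb hec
    exact ⟨A, B, hlift, hlift.hasRoles_iff.1 hr, .inl ⟨rfl, rfl⟩⟩
  · obtain ⟨A, B, hlift, rfl, rfl⟩ := h.exists_isLift_of_mem hp.symm hea heb hec
    exact ⟨A, B, hlift, hlift.hasRoles_iff.1 (hasRoles_comm.1 hr), .inr ⟨rfl, rfl⟩⟩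

lemma isTauArc_inc_iff (h : IsClaw G v a b c ea eb ec) (hr : G.HasRoles ea eb ec S T)
    (he : G.Inc e v) (hf : G.Inc f v) : G.IsTauArc e f S T ↔ (e = ec ∧ f = ea) ∨
      (e = ea ∧ f = ec ∧ G.pairCut S T ea ∩ G.pairCycle S T ea = {ea, ec}) := by
  have hcut : G.pairCut S T ea = G.pairCut T S ea := Set.ext fun _ => or_comm
  have hcycle : G.pairCycle S T ea = G.pairCycle T S ea := Set.ext fun _ => or_comm
  obtain ⟨A, B, hlift, hmem, ⟨rfl, rfl⟩ | ⟨rfl, rfl⟩⟩ := h.exists_isLift_of_hasRoles hr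
  · rw [hlift.isTauArc_inc_iff hmem he hf,
      pairCut_inter_pairCycle_eq_iff hlift.isTreePair (.inl rfl) (.inl rfl)]
  · rw [isTauArc_comm, hlift.isTauArc_inc_iff hmem he hf, hcut, hcycle,
      pairCut_inter_pairCycle_eq_iff hlift.isTreePair (.inl rfl) (.inl rfl)]

end IsClaw

/-! ### The four classes -/

end BispanningGraph

lemma Graph.Distinct.eq_or_eq_or_eq (h : Distinct i j k) (l : Fin 3) :
    l = i ∨ l = j ∨ l = k := by
  obtain ⟨hij, hik, hjk⟩ := h
  omega

namespace BispanningGraph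

lemma exists_distinct_two_one {P : Fin 3 → Prop} (h : ∃ i, P i) (h' : ∃ i, ¬ P i) :
    ∃ i j k, Distinct i j k ∧ (P i ∧ P j ∧ ¬ P k ∨ ¬ P i ∧ ¬ P j ∧ P k) := by
  obtain ⟨p, hp⟩ := h
  obtain ⟨q, hq⟩ := h'
  have hpq : p ≠ q := fun hpq => hq (hpq ▸ hp)
  obtain ⟨r, hpr, hqr⟩ : ∃ r, p ≠ r ∧ q ≠ r := by
    clear hp hq hpq
    revert p q
    decide
  by_cases hr : P r
  · exact ⟨p, r, q, ⟨hpr, hpq, hqr.symm⟩, .inl ⟨hp, hr, hq⟩⟩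
  · exact ⟨q, r, p, ⟨hqr, hpq.symm, hpr.symm⟩, .inr ⟨hq, hr, hp⟩⟩

/-- `IsClawLabelling G v x d`: the edges at `v` are `d 0`, `d 1`, `d 2`, with the other ends
`x 0`, `x 1`, `x 2`, in the sense of `IsClaw`. -/
def IsClawLabelling (G : Graph α β) (v : α) (x : Fin 3 → α) (d : Fin 3 → β) : Prop :=
  ∀ i j k, Distinct i j k → IsClaw G v (x i) (x j) (x k) (d i) (d j) (d k)

lemma isClawLabelling_of_deg_eq_three (hdeg : G.deg v = 3) (hd : Function.Injective d)
    (hlink : ∀ i, G.IsLink (d i) v (x i)) (hx : ∀ i, x i ≠ v) : IsClawLabelling G v x d := by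
  have hrange : Set.range d = {e | G.Inc e v} := by
    refine Set.Finite.eq_of_subset_of_encard_le (Set.finite_range d) ?_ ?_
    · rintro _ ⟨i, rfl⟩
      exact (hlink i).inc_left
    · rw [← Set.image_univ, hd.encard_image]
      simpa [deg] using hdeg.le
  intro i j k hijk
  refine ⟨hlink i, hlink j, hlink k, hx i, hx j, hx k, hd.ne hijk.1, hd.ne hijk.2.1,
    hd.ne hijk.2.2, fun e he => ?_⟩
  obtain ⟨l, rfl⟩ : e ∈ Set.range d := hrange ▸ he
  simpa only [hd.eq_iff] using hijk.eq_or_eq_or_eq l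

namespace IsClawLabelling

lemma inc (h : IsClawLabelling G v x d) (i : Fin 3) : G.Inc (d i) v := by
  obtain ⟨j, k, hijk⟩ : ∃ j k, Distinct i j k := by
    unfold Distinct
    revert i
    decide
  exact (h i j k hijk).isLink_a.inc_left

lemma exists_eq_of_inc (h : IsClawLabelling G v x d) (he : G.Inc e v) : ∃ i, e = d i := by
  rcases (h 0 1 2 (by simp [Distinct])).eq_of_inc e he with he | he | he
  exacts [⟨0, he⟩, ⟨1, he⟩, ⟨2, he⟩]

lemma exists_mem (h : IsClawLabelling G v x d) (hT : G.IsSpanningTree T) : ∃ i, d i ∈ T := by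
  have hclaw := h 0 1 2 (by simp [Distinct])
  obtain ⟨f, hf, hfv⟩ := exists_mem_inc hT hclaw.isLink_a hclaw.a_ne
  obtain ⟨i, rfl⟩ := h.exists_eq_of_inc hfv
  exact ⟨i, hf⟩

lemma exists_isLift (h : IsClawLabelling G v x d) (hp : G.IsTreePair S T) : ∃ i j k A B,
    Distinct i j k ∧ IsLift G v (x i) (x j) (x k) (d i) (d j) (d k) A B ∧
      (S = insert (d i) (insert (d j) A) ∧ T = insert (d k) B ∨
        S = insert (d k) B ∧ T = insert (d i) (insert (d j) A)) := by
  have hnot : ∃ i, d i ∉ S := (h.exists_mem hp.right).imp fun _ hi => hp.notMem_left hi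
  have hmem : ∀ i, d i ∉ S → d i ∈ T :=
    fun i hi => (hp.mem_or_mem (h.inc i).edge_mem).resolve_left hi
  obtain ⟨i, j, k, hijk, ⟨hi, hj, hk⟩ | ⟨hi, hj, hk⟩⟩ :=
    exists_distinct_two_one (h.exists_mem hp.left) hnot
  · obtain ⟨A, B, hlift, hS, hT⟩ := (h i j k hijk).exists_isLift_of_mem hp hi hj (hmem k hk)
    exact ⟨i, j, k, A, B, hijk, hlift, .inl ⟨hS, hT⟩⟩
  · obtain ⟨A, B, hlift, hT, hS⟩ :=
      (h i j k hijk).exists_isLift_of_mem hp.symm (hmem i hi) (hmem j hj) hk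
    exact ⟨i, j, k, A, B, hijk, hlift, .inr ⟨hS, hT⟩⟩

lemma exists_eq_rho (h : IsClawLabelling G v x d) (hp : G.IsTreePair S T) : ∃ i j k,
    Distinct i j k ∧ ∃ S₀ T₀, (G.reduction v (x i) (x j)).IsTreePair S₀ T₀ ∧
      (S, T) = rho (d i) (d j) (d k) S₀ T₀ := by
  obtain ⟨i, j, k, A, B, hijk, hlift, ⟨rfl, rfl⟩ | ⟨rfl, rfl⟩⟩ := h.exists_isLift hp
  · exact ⟨i, j, k, hijk, _, _, hlift.reduction, rho_insert_none_image.symm⟩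
  · exact ⟨i, j, k, hijk, _, _, hlift.reduction.symm, rho_image_insert_none.symm⟩

lemma exists_hasRoles (h : IsClawLabelling G v x d) (hp : G.IsTreePair S T) :
    ∃ i j k, Distinct i j k ∧ G.HasRoles (d i) (d j) (d k) S T := by
  obtain ⟨i, j, k, A, B, hijk, hlift, hST⟩ := h.exists_isLift hp
  have hroles : G.HasRoles (d i) (d j) (d k) S T ∨ G.HasRoles (d j) (d i) (d k) S T := by
    rcases hST with ⟨rfl, rfl⟩ | ⟨rfl, rfl⟩
    · exact hlift.hasRoles_or_hasRoles
    · exact hlift.hasRoles_or_hasRoles.imp hasRoles_comm.1 hasRoles_comm.1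
  rcases hroles with hroles | hroles
  · exact ⟨i, j, k, hijk, hroles⟩
  · exact ⟨j, i, k, ⟨hijk.1.symm, hijk.2.2, hijk.2.1⟩, hroles⟩

end IsClawLabelling

lemma eq_and_eq_of_hasRoles (hr : G.HasRoles (d i) (d j) (d k) S T)
    (hr' : G.HasRoles (d i') (d j') (d k') S T) (hd : Distinct i j k) (hd' : Distinct i' j' k') :
    i = i' ∧ k = k' := by
  obtain ⟨hp, hmem, hi, hj⟩ := hr
  obtain ⟨-, hmem', hi', hj'⟩ := hr'
  have hdisj : ∀ l, d l ∈ S → d l ∉ T := fun l hl => hp.notMem_right hl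
  have hk : k = k' := by
    rcases hd.eq_or_eq_or_eq i' with rfl | rfl | rfl <;>
      rcases hd.eq_or_eq_or_eq j' with rfl | rfl | rfl <;>
      rcases hd.eq_or_eq_or_eq k' with rfl | rfl | rfl <;>
      grind [Distinct]
  subst hk
  refine ⟨?_, rfl⟩
  rcases hd.eq_or_eq_or_eq i' with rfl | rfl | rfl
  · rfl
  · exact absurd hi' hj
  · exact absurd rfl hd'.2.1

namespace IsClawLabelling

lemma inClass_lifted_iff (h : IsClawLabelling G v x d) : G.InClass v x d e f S T .lifted ↔
    G.IsTauArc e f S T ∧ ¬ G.Inc e v ∧ ¬ G.Inc f v := by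
  constructor
  · rintro ⟨i, j, k, hijk, S₀, T₀, harc, hnot, hST⟩
    have he := (some_mem_edgeSet_reduction.1 harc.left_mem_edgeSet).2
    have hf := (some_mem_edgeSet_reduction.1 harc.right_mem_edgeSet).2
    have hlift := ((h i j k hijk).isTauArc_rho_some_iff harc.1 he hf).2 ⟨harc, hnot⟩
    rw [← hST] at hlift
    exact ⟨hlift, he, hf⟩
  · rintro ⟨harc, he, hf⟩
    obtain ⟨i, j, k, hijk, S₀, T₀, hp, hST⟩ := h.exists_eq_rho harc.1
    have hiff := (h i j k hijk).isTauArc_rho_some_iff hp he hf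
    rw [← hST] at hiff
    obtain ⟨harc, hnot⟩ := hiff.1 harc
    exact ⟨i, j, k, hijk, S₀, T₀, harc, hnot, hST⟩

lemma exists_isForwardEdge (h : IsClawLabelling G v x d) (harc : G.IsTauArc e f S T)
    (he : ¬ G.Inc e v) (hf : G.Inc f v) : ∃ i j k, Distinct i j k ∧ ∃ S₀ T₀,
      (G.reduction v (x i) (x j)).IsTauArc (some e) none S₀ T₀ ∧
      G.IsForwardEdge (d i) (d j) (d k) e S₀ T₀ f ∧ (S, T) = rho (d i) (d j) (d k) S₀ T₀ := by
  obtain ⟨i, j, k, hijk, S₀, T₀, hp, hST⟩ := h.exists_eq_rho harc.1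
  have hiff := (h i j k hijk).isTauArc_rho_none_iff hp he hf
  rw [← hST] at hiff
  obtain ⟨harc, hfwd⟩ := hiff.1 harc
  exact ⟨i, j, k, hijk, S₀, T₀, harc, hfwd, hST⟩

lemma inClass_forwarded_iff (h : IsClawLabelling G v x d) :
    G.InClass v x d e f S T .forwarded ↔ G.IsTauArc e f S T ∧ Xor (G.Inc e v) (G.Inc f v) := by
  constructor
  · rintro ⟨i, j, k, hijk, S₀, T₀, g, e₂, harc, hfwd, hST⟩
    have hg : ¬ G.Inc g v := (some_mem_edgeSet_reduction.1 harc.left_mem_edgeSet).2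
    have he₂ : G.Inc e₂ v := by
      rcases hfwd.1 with rfl | rfl
      exacts [h.inc i, h.inc j]
    have hlift := ((h i j k hijk).isTauArc_rho_none_iff harc.1 hg he₂).2 ⟨harc, hfwd⟩
    rcases hST with ⟨rfl, rfl, hST⟩ | ⟨rfl, rfl, hST⟩
    · rw [← hST] at hlift
      exact ⟨hlift, .inr ⟨he₂, hg⟩⟩
    · have hrev := hlift.reverse
      rw [← hST] at hrev
      exact ⟨hrev, .inl ⟨he₂, hg⟩⟩
  · rintro ⟨harc, ⟨he, hf⟩ | ⟨hf, he⟩⟩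
    · obtain ⟨i, j, k, hijk, S₀, T₀, harc₀, hfwd, hST⟩ := h.exists_isForwardEdge harc.reverse hf he
      refine ⟨i, j, k, hijk, S₀, T₀, f, e, harc₀, hfwd, .inr ⟨rfl, rfl, ?_⟩⟩
      rw [← hST, harc.exchange_exchange]
    · obtain ⟨i, j, k, hijk, S₀, T₀, harc₀, hfwd, hST⟩ := h.exists_isForwardEdge harc he hf
      exact ⟨i, j, k, hijk, S₀, T₀, e, f, harc₀, hfwd, .inl ⟨rfl, rfl, hST⟩⟩

lemma inClass_leaf_or_extra_iff (h : IsClawLabelling G v x d) :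
    G.InClass v x d e f S T .leaf ∨ G.InClass v x d e f S T .extra ↔
      G.IsTauArc e f S T ∧ G.Inc e v ∧ G.Inc f v := by
  constructor
  · rintro (⟨i, j, k, hijk, hr, rfl, rfl⟩ | ⟨i, j, k, hijk, hr, rfl, rfl, hcut⟩)
    · exact ⟨((h i j k hijk).isTauArc_inc_iff hr (h.inc k) (h.inc i)).2 (.inl ⟨rfl, rfl⟩),
        h.inc k, h.inc i⟩
    · exact ⟨((h i j k hijk).isTauArc_inc_iff hr (h.inc i) (h.inc k)).2 (.inr ⟨rfl, rfl, hcut⟩),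
        h.inc i, h.inc k⟩
  · rintro ⟨harc, he, hf⟩
    obtain ⟨i, j, k, hijk, hr⟩ := h.exists_hasRoles harc.1
    exact (((h i j k hijk).isTauArc_inc_iff hr he hf).1 harc).imp
      (fun hleaf => ⟨i, j, k, hijk, hr, hleaf⟩)
      fun hextra => ⟨i, j, k, hijk, hr, hextra⟩

lemma not_leaf_and_extra (h : IsClawLabelling G v x d) :
    ¬ (G.InClass v x d e f S T .leaf ∧ G.InClass v x d e f S T .extra) := by
  rintro ⟨⟨i, j, k, hijk, hr, hek, -⟩, ⟨i', j', k', hijk', hr', hei, -⟩⟩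
  obtain ⟨rfl, -⟩ := eq_and_eq_of_hasRoles hr hr' hijk hijk'
  exact (h i j k hijk).ea_ne_ec (hei.symm.trans hek)

lemma existsUnique_leaf (h : IsClawLabelling G v x d) (hp : G.IsTreePair S T) :
    ∃! p : β × β, G.InClass v x d p.1 p.2 S T .leaf := by
  obtain ⟨i, j, k, hijk, hr⟩ := h.exists_hasRoles hp
  refine ⟨(d k, d i), ⟨i, j, k, hijk, hr, rfl, rfl⟩, ?_⟩
  rintro ⟨e, f⟩ ⟨i', j', k', hijk', hr', he, hf⟩
  obtain ⟨rfl, rfl⟩ := eq_and_eq_of_hasRoles hr hr' hijk hijk'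
  exact Prod.ext he hf

lemma isTauArc_of_inClass (h : IsClawLabelling G v x d) {c : ExchangeClass}
    (hc : G.InClass v x d e f S T c) : G.IsTauArc e f S T := by
  cases c with
  | lifted => exact (h.inClass_lifted_iff.1 hc).1
  | leaf => exact (h.inClass_leaf_or_extra_iff.1 (.inl hc)).1
  | forwarded => exact (h.inClass_forwarded_iff.1 hc).1
  | extra => exact (h.inClass_leaf_or_extra_iff.1 (.inr hc)).1

lemma existsUnique_inClass (h : IsClawLabelling G v x d) (harc : G.IsTauArc e f S T) :
    ∃! c, G.InClass v x d e f S T c := by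
  have hlifted := h.inClass_lifted_iff (e := e) (f := f) (S := S) (T := T)
  have hforwarded := h.inClass_forwarded_iff (e := e) (f := f) (S := S) (T := T)
  have hboth := h.inClass_leaf_or_extra_iff (e := e) (f := f) (S := S) (T := T)
  have hnot := h.not_leaf_and_extra (e := e) (f := f) (S := S) (T := T)
  simp only [harc, true_and] at hlifted hforwarded hboth
  have hsome : ∃ c, G.InClass v x d e f S T c := by
    by_cases he : G.Inc e v <;> by_cases hf : G.Inc f v
    · exact (hboth.2 ⟨he, hf⟩).elim (⟨_, ·⟩) (⟨_, ·⟩)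
    · exact ⟨_, hforwarded.2 (.inl ⟨he, hf⟩)⟩
    · exact ⟨_, hforwarded.2 (.inr ⟨hf, he⟩)⟩
    · exact ⟨_, hlifted.2 ⟨he, hf⟩⟩
  refine existsUnique_of_exists_of_unique hsome fun c c' hc hc' => ?_
  rw [Xor] at hforwarded
  cases c <;> cases c' <;> first | rfl | (exfalso; tauto)

end IsClawLabelling

end BispanningGraph

end

theorem mainTheorem3_general {α β : Type*} (G : Graph α β) (v : α) (hdeg : G.deg v = 3)
    (x : Fin 3 → α) (d : Fin 3 → β) (hd : Function.Injective d)
    (hlink : ∀ i, G.IsLink (d i) v (x i)) (hx : ∀ i, x i ≠ v) :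
    (∀ e f S T, G.IsTauArc e f S T → ∃! c, G.InClass v x d e f S T c) ∧
    (∀ c e f S T, G.InClass v x d e f S T c → G.IsTauArc e f S T) ∧
    (∀ S T, G.IsTreePair S T → ∃! p : β × β, G.InClass v x d p.1 p.2 S T .leaf) ∧
    (∀ i j k, Graph.Distinct i j k → ∀ (S₀ T₀ : Set (Option β)) (g : β),
      (G.reduction v (x i) (x j)).IsTauArc (some g) none S₀ T₀ →
        ∃! e₂, G.IsForwardEdge (d i) (d j) (d k) g S₀ T₀ e₂) := by
  have hlabel := BispanningGraph.isClawLabelling_of_deg_eq_three hdeg hd hlink hx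
  refine ⟨fun e f S T harc => ?_, fun c e f S T hc => ?_, fun S T hp => ?_,
    fun i j k hijk S₀ T₀ g harc => ?_⟩
  · exact hlabel.existsUnique_inClass harc
  · exact hlabel.isTauArc_of_inClass hc
  · exact hlabel.existsUnique_leaf hp
  · exact (hlabel i j k hijk).existsUnique_isForwardEdge harc

theorem mainTheorem3 {α β : Type*} (G : Graph α β) (hG : G.IsAtomic)
    (v : α) (hv : v ∈ V(G)) (hdeg : G.deg v = 3)
    (x : Fin 3 → α) (d : Fin 3 → β) (hd : Function.Injective d)
    (hlink : ∀ i, G.IsLink (d i) v (x i)) :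
    -- every unique exchange lies in exactly one of the four classes
    (∀ e f S T, G.IsTauArc e f S T → ∃! c, G.InClass v x d e f S T c) ∧
    -- every member of the four classes is a unique exchange
    (∀ c e f S T, G.InClass v x d e f S T c → G.IsTauArc e f S T) ∧
    -- every tree pair has exactly one exchange of the leaf class
    (∀ S T, G.IsTreePair S T → ∃! p : β × β, G.InClass v x d p.1 p.2 S T .leaf) ∧
    -- every unique exchange targeting a split edge is forwarded to exactly one edge
    (∀ i j k, Graph.Distinct i j k → ∀ (S₀ T₀ : Set (Option β)) (g : β),
      (G.reduction v (x i) (x j)).IsTauArc (some g) none S₀ T₀ →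
        ∃! e₂, G.IsForwardEdge (d i) (d j) (d k) g S₀ T₀ e₂) := by
  exact mainTheorem3_general G v hdeg x d hd hlink fun i => hG.1.ne_of_isLink (hlink i)
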